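/- **Orders.** A dcpo is a poset in which every nonempty directed set has a supremum; a map between dcpos is Scott continuous if it is monotone and preserves suprema of nonempty directed sets. A poset is finitely preceded if every element has only finitely many elements strictly below it. **LPOFs.** Fix an infinite set $\mathsf{Nodes}$. Formulae are built from $\mathsf{true}$, $\mathsf{false}$, $\land,\lor,\lnot$ and variables $x\in\mathsf{Nodes}$; valuations $\mathsf{Nodes}\to\{0,1\}$, satisfiability and $\psi\Rightarrow\psi'$ are as usual. For a strict order $<$ let $x{\downarrow}=\{y\mid y<x\}$, $x{\uparrow}=\{y\mid x<y\}$, and let $\mathrm{succ}(x)$ be the set of immediate successors. Let $L$ be a poset with least element $\bot$. An LPOF over $L$ is $\alpha=\langle N,<,\lambda,\varphi\rangle$ with $N\subseteq\mathsf{Nodes}$ countable; $<$ a strict order on $N$ such that every $x{\downarrow}$ is finite, each level (nodes whose longest path of immediate successors from a minimal node has a given length) is finite, and there is exactly one minimal node; $\lambda:N\to L$ with $\mathrm{succ}(x)=\emptyset$ whenever $\lambda(x)=\bot$; and $\varphi$ assigning to each $x\in N$ a satisfiable formula with variables in $x{\downarrow}$, such that $\varphi(y)\Rightarrow\varphi(x)$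 if $x<y$. Put $\alpha\sqsubseteq\beta$ iff $N_\alpha$ is a downward closed subset of $N_\beta$, $<_\alpha$ is the restriction of $<_\beta$ to $N_\alpha$, and for all $x\in N_\alpha$: $\lambda_\alpha(x)\le\lambda_\beta(x)$, $\varphi_\alpha(x)=\varphi_\beta(x)$ and $\mathrm{succ}_\alpha(x)=\mathrm{succ}_\beta(x)\setminus\bigcup_{z\in N_\alpha,\lambda_\alpha(z)=\bot}z{\uparrow}_\beta$. Two LPOFs are isomorphic if a bijection of their nodes carries $<$, $\lambda$ and $\varphi$ (by renaming of variables) from one to the other. A pomset is an isomorphism class of LPOFs; it is finite if it has finitely many nodes. Put $A\sqsubseteq B$ iff $\alpha\sqsubseteq\beta$ for some $\alpha\in A$, $\beta\in B$. **Labels.** Let $\mathsf{Act}$ be a finitely preceded dcpo and $\mathsf{Test}$ a set, and let $\mathsf{Lab}=\mathsf{Act}\sqcup\mathsf{Test}\sqcup\{\mathsf{fork},\bot\}$, where $\bot$ is least, actions are ordered as in $\mathsf{Act}$ and all other labels are incomparable. Let $\mathsf{Pom}$ and $\mathsf{Pom}_{\mathrm{fin}}$ be the sets of pomsets and of finite pomsets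 over $\mathsf{Lab}$. **Computational domain.** Let $S$ be a set of states and $D$ a monad in Kleisli form: dcpos $D(X)$ for all sets $X$, with $\eta:X\to D(X)$ and $(-)^\dagger:(X\to D(Y))\to D(X)\to D(Y)$ such that $f^\dagger\circ\eta=f$, $\eta^\dagger=\mathrm{id}$, $(g^\dagger\circ f)^\dagger=g^\dagger\circ f^\dagger$, and $f^\dagger(d)$ is Scott continuous in $(f,d)$ jointly. Let $D(S)$ have a least element $\bot_D$ and an associative, commutative, monotone operation $\&$, and for $f:S\to D(S)$ let $f^\dagger(\bot_D)=\bot_D$ and $f^\dagger(d\,\&\,d')=f^\dagger(d)\,\&\,f^\dagger(d')$. Let $[\![-]\!]:\mathsf{Act}\to S\to D(S)$ be monotone in the action, and let $[\![-]\!]:\mathsf{Test}\to S\to\{0,1\}$. Functions into $D(S)$ are ordered pointwise. **Linearization.** For a finite LPOF $\alpha$ over $\mathsf{Lab}$, a formula $\psi$ and a set $P$ of nodes, let $\mathrm{next}(\alpha,\psi,P)=\{x\in N_\alpha\setminus P\mid x{\downarrow}_\alpha\subseteq P,\ \psi\Rightarrow\varphi_\alpha(x)\}$. Define $\mathrm{lin}_{\mathrm{LPO}}(\alpha,\psi,P)(s)=\eta(s)$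 if this set is empty, and otherwise let it be the $\&$-combination over all $x\in\mathrm{next}(\alpha,\psi,P)$ of - $\mathrm{lin}_{\mathrm{LPO}}(\alpha,\psi,P\cup\{x\})^\dagger([\![\lambda_\alpha(x)]\!](s))$ if $\lambda_\alpha(x)\in\mathsf{Act}$; - $\mathrm{lin}_{\mathrm{LPO}}(\alpha,\psi\land\ell,P\cup\{x\})(s)$ if $\lambda_\alpha(x)\in\mathsf{Test}$, where $\ell$ is $x$ if $[\![\lambda_\alpha(x)]\!](s)=1$ and $\lnot x$ otherwise; - $\bot_D$ if $\lambda_\alpha(x)=\bot$; - $\mathrm{lin}_{\mathrm{LPO}}(\alpha,\psi,P\cup\{x\})(s)$ if $\lambda_\alpha(x)=\mathsf{fork}$. Put $\mathrm{lin}_{\mathrm{fin}}([\alpha])=\mathrm{lin}_{\mathrm{LPO}}(\alpha,\mathsf{true},\emptyset)$ for finite $\alpha$, and $\mathrm{lin}(A)=\sup\{\mathrm{lin}_{\mathrm{fin}}(B)\mid B\in\mathsf{Pom}_{\mathrm{fin}},\ B\sqsubseteq A\}$ for $A\in\mathsf{Pom}$. **Claim.** (i) $\mathrm{lin}_{\mathrm{fin}}$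 is well defined: it does not depend on the representative. (ii) $\mathrm{lin}_{\mathrm{fin}}$ is monotone: if $A\sqsubseteq B$ in $\mathsf{Pom}_{\mathrm{fin}}$, then $\mathrm{lin}_{\mathrm{fin}}(A)\sqsubseteq\mathrm{lin}_{\mathrm{fin}}(B)$. (iii) The suprema that define $\mathrm{lin}$ exist. (iv) $\mathsf{Pom}$ and $S\to D(S)$ are dcpos, and $\mathrm{lin}:\mathsf{Pom}\to(S\to D(S))$ is Scott continuous. -/

import Mathlib

open Set

universe u v

/-! ### Directed-complete partial orders and Scott continuity -/

/-- A directed-complete partial order: every nonempty directed set has a supremum. -/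
structure IsDCPO (X : Type*) [LE X] : Prop where
  le_refl : ∀ x : X, x ≤ x
  le_trans : ∀ x y z : X, x ≤ y → y ≤ z → x ≤ z
  le_antisymm : ∀ x y : X, x ≤ y → y ≤ x → x = y
  exists_isLUB : ∀ S : Set X, S.Nonempty → DirectedOn (· ≤ ·) S → ∃ x, IsLUB S x

/-- Monotone and preserving the suprema of nonempty directed sets. -/
structure IsScottContinuous {X Y : Type*} [LE X] [LE Y] (f : X → Y) : Prop where
  mono : ∀ x y : X, x ≤ y → f x ≤ f y
  isLUB_image : ∀ S : Set X, S.Nonempty → DirectedOn (· ≤ ·) S →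
    ∀ x, IsLUB S x → IsLUB (f '' S) (f x)

/-- Every element has only finitely many elements strictly below it. -/
def FinitelyPreceded (X : Type*) [LT X] : Prop := ∀ x : X, {y | y < x}.Finite

/-! ### Boolean formulae over nodes -/

inductive Formula (Node : Type*) where
  | tru : Formula Node
  | fls : Formula Node
  | and : Formula Node → Formula Node → Formula Node
  | or : Formula Node → Formula Node → Formula Node
  | not : Formula Node → Formula Node
  | var : Node → Formula Node

namespace Formula

variable {Node : Type*}

/-- `ψ.Holds v` is satisfaction of `ψ` by the valuation `v`. -/
def Holds (v : Node → Bool) : Formula Node → Prop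
  | tru => True
  | fls => False
  | and ψ χ => ψ.Holds v ∧ χ.Holds v
  | or ψ χ => ψ.Holds v ∨ χ.Holds v
  | not ψ => ¬ ψ.Holds v
  | var x => v x = true

/-- The nodes that occur in a formula. -/
def free : Formula Node → Set Node
  | tru => ∅
  | fls => ∅
  | and ψ χ => ψ.free ∪ χ.free
  | or ψ χ => ψ.free ∪ χ.free
  | not ψ => ψ.free
  | var x => {x}

def Sat (ψ : Formula Node) : Prop := ∃ v, ψ.Holds v

def Implies (ψ χ : Formula Node) : Prop := ∀ v, ψ.Holds v → χ.Holds v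

/-- Syntactic renaming of the variables. -/
def rename (f : Node → Node) : Formula Node → Formula Node
  | tru => tru
  | fls => fls
  | and ψ χ => and (ψ.rename f) (χ.rename f)
  | or ψ χ => or (ψ.rename f) (χ.rename f)
  | not ψ => not (ψ.rename f)
  | var x => var (f x)

/-- The literal `x` if `b` is true, and `¬ x` otherwise. -/
def literal (x : Node) (b : Bool) : Formula Node := if b then var x else not (var x)

theorem rename_congr {f g : Node → Node} (ψ : Formula Node) (h : ∀ x ∈ ψ.free, f x = g x) :
    ψ.rename f = ψ.rename g := by
  induction ψ with
  | tru => rfl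
  | fls => rfl
  | and ψ χ h₁ h₂ =>
    simp only [rename, free] at *
    rw [h₁ fun x hx => h x (Or.inl hx), h₂ fun x hx => h x (Or.inr hx)]
  | or ψ χ h₁ h₂ =>
    simp only [rename, free] at *
    rw [h₁ fun x hx => h x (Or.inl hx), h₂ fun x hx => h x (Or.inr hx)]
  | not ψ h₁ =>
    simp only [rename, free] at *
    rw [h₁ h]
  | var x => simp only [rename]; rw [h x rfl]

theorem rename_id (ψ : Formula Node) : ψ.rename (fun x => x) = ψ := by
  induction ψ <;> simp_all [rename]

theorem rename_rename (f g : Node → Node) (ψ : Formula Node) :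
    (ψ.rename f).rename g = ψ.rename (fun x => g (f x)) := by
  induction ψ <;> simp_all [rename]

end Formula

/-! ### Strict posets on a set of nodes -/

namespace NodeOrder

variable {Node : Type*}

/-- The upward closure `{y | x < y}` of a node. -/
def succPlus (lt : Node → Node → Prop) (x : Node) : Set Node := {y | lt x y}

/-- The downward closure `{y | y < x}` of a node. -/
def predPlus (lt : Node → Node → Prop) (x : Node) : Set Node := {y | lt y x}

/-- Immediate successors. -/
def succ (lt : Node → Node → Prop) (x : Node) : Set Node := {y | lt x y ∧ ¬ ∃ z, lt x z ∧ lt z y}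

/-- Immediate predecessors. -/
def pred (lt : Node → Node → Prop) (x : Node) : Set Node := {y | lt y x ∧ ¬ ∃ z, lt y z ∧ lt z x}

/-- Minimal nodes of the poset `(N, <)`. -/
def min (N : Set Node) (lt : Node → Node → Prop) : Set Node := {x ∈ N | pred lt x = ∅}

/-- The length of the longest path of immediate successors from a minimal node to `x`. -/
noncomputable def level (N : Set Node) (lt : Node → Node → Prop) (x : Node) : ℕ :=
  sSup {n | ∃ c : ℕ → Node, c 0 ∈ min N lt ∧ c n = x ∧ ∀ i < n, c (i + 1) ∈ succ lt (c i)}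

end NodeOrder

open NodeOrder in
/-- A labelled partial order with formulae over the label set `L`. The values of `label` and
`formula` outside of `nodes` carry no meaning: neither the order nor isomorphism looks at them. -/
structure LPOF (Node : Type*) (L : Type*) [PartialOrder L] [OrderBot L] where
  nodes : Set Node
  lt : Node → Node → Prop
  label : Node → L
  formula : Node → Formula Node
  nodes_countable : nodes.Countable
  mem_of_lt : ∀ x y, lt x y → x ∈ nodes ∧ y ∈ nodes
  lt_irrefl : ∀ x, ¬ lt x x
  lt_trans : ∀ x y z, lt x y → lt y z → lt x z
  finitely_preceded : ∀ x ∈ nodes, (predPlus lt x).Finite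
  finite_level : ∀ n : ℕ, {x ∈ nodes | level nodes lt x = n}.Finite
  single_rooted : ∃! x, x ∈ min nodes lt
  succ_of_bot : ∀ x ∈ nodes, label x = ⊥ → succ lt x = ∅
  formula_sat : ∀ x ∈ nodes, (formula x).Sat
  formula_free : ∀ x ∈ nodes, (formula x).free ⊆ predPlus lt x
  formula_implies : ∀ x y, lt x y → (formula y).Implies (formula x)

namespace LPOF

variable {Node L : Type*} [PartialOrder L] [OrderBot L]

/-- The nodes labelled `⊥`. -/
def botNodes (α : LPOF Node L) : Set Node := {x ∈ α.nodes | α.label x = ⊥}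

/-- The order on LPOFs. -/
structure Le (α β : LPOF Node L) : Prop where
  nodes_subset : α.nodes ⊆ β.nodes
  down_closed : ∀ y ∈ α.nodes, NodeOrder.predPlus β.lt y ⊆ α.nodes
  lt_iff : ∀ x y, α.lt x y ↔ β.lt x y ∧ x ∈ α.nodes ∧ y ∈ α.nodes
  label_le : ∀ x ∈ α.nodes, α.label x ≤ β.label x
  formula_eq : ∀ x ∈ α.nodes, α.formula x = β.formula x
  succ_eq : ∀ x ∈ α.nodes, NodeOrder.succ α.lt x =
    NodeOrder.succ β.lt x \ ⋃ z ∈ α.botNodes, NodeOrder.succPlus β.lt z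

/-- `f` restricts to a bijection from the nodes of `α` to those of `β` that carries `α` to `β`. -/
structure IsIso (α β : LPOF Node L) (f : Node → Node) : Prop where
  bijOn : BijOn f α.nodes β.nodes
  lt_iff : ∀ x ∈ α.nodes, ∀ y ∈ α.nodes, α.lt x y ↔ β.lt (f x) (f y)
  label_eq : ∀ x ∈ α.nodes, β.label (f x) = α.label x
  formula_eq : ∀ x ∈ α.nodes, β.formula (f x) = (α.formula x).rename f

def Iso (α β : LPOF Node L) : Prop := ∃ f : Node → Node, IsIso α β f

theorem formula_free_subset (α : LPOF Node L) {x : Node} (hx : x ∈ α.nodes) :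
    (α.formula x).free ⊆ α.nodes :=
  fun _ hy => (α.mem_of_lt _ _ (α.formula_free x hx hy)).1

theorem Iso.refl (α : LPOF Node L) : Iso α α :=
  ⟨fun x => x, ⟨bijOn_id _, fun _ _ _ _ => Iff.rfl, fun _ _ => rfl,
    fun x _ => (Formula.rename_id (α.formula x)).symm⟩⟩

theorem Iso.symm {α β : LPOF Node L} (h : Iso α β) : Iso β α := by
  obtain ⟨f, hf⟩ := h
  obtain ⟨r, -⟩ := α.single_rooted
  have : Nonempty Node := ⟨r⟩
  have hinv := hf.bijOn.invOn_invFunOn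
  have hg : BijOn (Function.invFunOn f α.nodes) β.nodes α.nodes := hf.bijOn.symm hinv.symm
  refine ⟨Function.invFunOn f α.nodes, hg, ?_, ?_, ?_⟩
  · intro x hx y hy
    rw [hf.lt_iff _ (hg.mapsTo hx) _ (hg.mapsTo hy), hinv.2 hx, hinv.2 hy]
  · intro x hx
    rw [← hf.label_eq _ (hg.mapsTo hx), hinv.2 hx]
  · intro x hx
    have h := hf.formula_eq _ (hg.mapsTo hx)
    rw [hinv.2 hx] at h
    rw [h, Formula.rename_rename]
    refine Eq.trans (Formula.rename_id _).symm (Formula.rename_congr _ fun y hy => ?_)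
    exact (hinv.1 (α.formula_free_subset (hg.mapsTo hx) hy)).symm

theorem Iso.trans {α β γ : LPOF Node L} (h : Iso α β) (h' : Iso β γ) : Iso α γ := by
  obtain ⟨f, hf⟩ := h
  obtain ⟨g, hg⟩ := h'
  refine ⟨fun x => g (f x), hg.bijOn.comp hf.bijOn, ?_, ?_, ?_⟩
  · intro x hx y hy
    rw [hf.lt_iff x hx y hy, hg.lt_iff _ (hf.bijOn.mapsTo hx) _ (hf.bijOn.mapsTo hy)]
  · intro x hx
    rw [hg.label_eq _ (hf.bijOn.mapsTo hx), hf.label_eq x hx]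
  · intro x hx
    rw [hg.formula_eq _ (hf.bijOn.mapsTo hx), hf.formula_eq x hx, Formula.rename_rename]

instance isoSetoid (Node L : Type*) [PartialOrder L] [OrderBot L] : Setoid (LPOF Node L) :=
  ⟨Iso, Iso.refl, Iso.symm, Iso.trans⟩

theorem Iso.finite_iff {α β : LPOF Node L} (h : Iso α β) : α.nodes.Finite ↔ β.nodes.Finite := by
  obtain ⟨f, hf⟩ := h
  exact hf.bijOn.finite_iff_finite

end LPOF

/-! ### Pomsets with formulae -/

/-- Isomorphism classes of LPOFs. -/
def Pom (Node L : Type*) [PartialOrder L] [OrderBot L] : Type _ :=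
  Quotient (LPOF.isoSetoid Node L)

namespace Pom

variable {Node L : Type*} [PartialOrder L] [OrderBot L]

def mk (α : LPOF Node L) : Pom Node L := Quotient.mk _ α

/-- The order on pomsets: some representatives are related. -/
instance : LE (Pom Node L) := ⟨fun A B => ∃ α β : LPOF Node L, mk α = A ∧ mk β = B ∧ α.Le β⟩

def IsFinite (A : Pom Node L) : Prop :=
  Quotient.lift (fun α : LPOF Node L => α.nodes.Finite) (fun _ _ h => propext (LPOF.Iso.finite_iff h)) A

end Pom

/-- Finite pomsets. -/
abbrev FinPom (Node L : Type*) [PartialOrder L] [OrderBot L] := {A : Pom Node L // A.IsFinite}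

namespace FinPom

variable {Node L : Type*} [PartialOrder L] [OrderBot L]

def mk (α : LPOF Node L) (hα : α.nodes.Finite) : FinPom Node L := ⟨Pom.mk α, hα⟩

noncomputable def rep (A : FinPom Node L) : LPOF Node L := Quotient.out A.1

theorem rep_finite (A : FinPom Node L) : A.rep.nodes.Finite := by
  have h : (Pom.mk A.rep).IsFinite := by
    have : Pom.mk A.rep = A.1 := Quotient.out_eq A.1
    rw [this]; exact A.2
  exact h

end FinPom

/-- The finite approximations of a pomset. -/
def finApprox {Node L : Type*} [PartialOrder L] [OrderBot L] (A : Pom Node L) :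
    Set (FinPom Node L) := {B | B.1 ≤ A}

/-! ### The label set of the programming language -/

inductive Label (Act Test : Type*) where
  | bot : Label Act Test
  | fork : Label Act Test
  | act : Act → Label Act Test
  | test : Test → Label Act Test

namespace Label

variable {Act Test : Type*} [PartialOrder Act]

/-- `⊥` is least, actions are ordered as in `Act`, and all other labels are incomparable. -/
inductive Le : Label Act Test → Label Act Test → Prop
  | bot (l : Label Act Test) : Le bot l
  | fork : Le fork fork
  | act {a b : Act} : a ≤ b → Le (act a) (act b)
  | test (t : Test) : Le (test t) (test t)

instance : PartialOrder (Label Act Test) where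
  le := Le
  le_refl l := by
    cases l with
    | bot => exact Le.bot _
    | fork => exact Le.fork
    | act a => exact Le.act (le_refl a)
    | test t => exact Le.test t
  le_trans _ _ _ h h' := by
    cases h with
    | bot => exact Le.bot _
    | fork => exact h'
    | act h => cases h' with
      | act h' => exact Le.act (h.trans h')
    | test t => exact h'
  le_antisymm _ _ h h' := by
    cases h with
    | bot => cases h'; rfl
    | fork => rfl
    | act h => cases h' with
      | act h' => rw [le_antisymm h h']
    | test t => rfl

instance : OrderBot (Label Act Test) where
  bot := bot
  bot_le := Le.bot

end Label

/-! ### Computational domains -/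

/-- A computational domain for the state space `State`: a monad `D` in Kleisli form whose values
are dcpos (a set `X` is regarded as a discrete dcpo) and whose Kleisli extension is Scott continuous
in both arguments together, such that `D State` is pointed and has a nondeterminism operator, the
Kleisli extension being strict and additive. -/
structure ComputationalDomain (D : Type u → Type v) [∀ X, PartialOrder (D X)]
    (State : Type u) where
  isDCPO : ∀ X, IsDCPO (D X)
  bot : D State
  bot_le : ∀ d, bot ≤ d
  nd : D State → D State → D State
  nd_assoc : ∀ d e f, nd (nd d e) f = nd d (nd e f)
  nd_comm : ∀ d e, nd d e = nd e d
  nd_mono : ∀ d d' e e', d ≤ d' → e ≤ e' → nd d e ≤ nd d' e'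
  unit : ∀ {X : Type u}, X → D X
  ext : ∀ {X Y : Type u}, (X → D Y) → D X → D Y
  ext_unit : ∀ {X Y : Type u} (f : X → D Y) (x : X), ext f (unit x) = f x
  unit_ext : ∀ {X : Type u} (d : D X), ext unit d = d
  ext_ext : ∀ {X Y Z : Type u} (g : Y → D Z) (f : X → D Y) (d : D X),
    ext (fun x => ext g (f x)) d = ext g (ext f d)
  ext_continuous : ∀ {X Y : Type u} (F : Set (X → D Y)) (E : Set (D X)) (f : X → D Y) (e : D X),
    F.Nonempty → DirectedOn (· ≤ ·) F → IsLUB F f →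
    E.Nonempty → DirectedOn (· ≤ ·) E → IsLUB E e →
    IsLUB (Set.image2 ext F E) (ext f e)
  ext_bot : ∀ f : State → D State, ext f bot = bot
  ext_nd : ∀ (f : State → D State) (d e : D State), ext f (nd d e) = nd (ext f d) (ext f e)

/-- `d₁ & (d₂ & ⋯ & dₙ)` for a nonempty list; the value `z` at the empty list is never used. -/
def bigNd {T : Type*} (nd : T → T → T) (z : T) : List T → T
  | [] => z
  | [d] => d
  | d :: e :: l => nd d (bigNd nd z (e :: l))

/-! ### Linearization -/

section Linearization

variable {Node Act Test : Type*} [PartialOrder Act]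

/-- The nodes that are ready to be scheduled. -/
def next (α : LPOF Node (Label Act Test)) (ψ : Formula Node) (S : Set Node) : Set Node :=
  {x ∈ α.nodes \ S | NodeOrder.predPlus α.lt x ⊆ S ∧ ψ.Implies (α.formula x)}

theorem next_finite {α : LPOF Node (Label Act Test)} (hα : α.nodes.Finite) (ψ : Formula Node)
    (S : Set Node) : (next α ψ S).Finite :=
  hα.subset fun _ hx => hx.1.1

theorem ncard_diff_insert_lt {N S : Set Node} (hN : N.Finite) {x : Node} (hx : x ∈ N \ S) :
    (N \ (S ∪ {x})).ncard < (N \ S).ncard := by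
  refine Set.ncard_lt_ncard ⟨fun y hy => ⟨hy.1, fun h => hy.2 (Or.inl h)⟩, fun h => ?_⟩ hN.sdiff
  exact (h hx).2 (Or.inr rfl)

variable {State : Type u} {D : Type u → Type v} [∀ X, PartialOrder (D X)]

open Classical in
/-- Linearization of a finite LPOF, given the path condition `ψ` and the set `S` of the nodes that
have already been processed. -/
noncomputable def linLPO (C : ComputationalDomain D State) (actSem : Act → State → D State)
    (testSem : Test → State → Bool) (α : LPOF Node (Label Act Test)) (hα : α.nodes.Finite)
    (ψ : Formula Node) (S : Set Node) (s : State) : D State :=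
  if next α ψ S = ∅ then C.unit s
  else bigNd C.nd C.bot ((next_finite hα ψ S).toFinset.toList.attach.map fun x =>
    match α.label x.1 with
    | .act a => C.ext (fun s' => linLPO C actSem testSem α hα ψ (S ∪ {x.1}) s') (actSem a s)
    | .test b =>
      linLPO C actSem testSem α hα (ψ.and (Formula.literal x.1 (testSem b s))) (S ∪ {x.1}) s
    | .bot => C.bot
    | .fork => linLPO C actSem testSem α hα ψ (S ∪ {x.1}) s)
termination_by (α.nodes \ S).ncard
decreasing_by
  all_goals
    refine ncard_diff_insert_lt hα ?_
    have hx := x.2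
    rw [Finset.mem_toList, Set.Finite.mem_toFinset] at hx
    exact hx.1

/-- Linearization of finite pomsets, through a representative. -/
noncomputable def linFin (C : ComputationalDomain D State) (actSem : Act → State → D State)
    (testSem : Test → State → Bool) (A : FinPom Node (Label Act Test)) : State → D State :=
  linLPO C actSem testSem A.rep A.rep_finite Formula.tru ∅

/-- The supremum of `S` if there is one, and the default value `z` otherwise. -/
noncomputable def supOr {T : Type*} [LE T] (z : T) (S : Set T) : T :=
  open Classical in if h : ∃ t, IsLUB S t then h.choose else z

/-- Linearization of arbitrary pomsets: the supremum over all finite approximations. -/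
noncomputable def lin (C : ComputationalDomain D State) (actSem : Act → State → D State)
    (testSem : Test → State → Bool) (A : Pom Node (Label Act Test)) : State → D State :=
  supOr (fun _ => C.bot) (linFin C actSem testSem '' finApprox A)

end Linearization

/-!
For LPOFs `α ⊑ β`, the condition on immediate successors says that all nodes of `β` outside of `α`
lie above a node that `α` labels with `⊥` (`LPOF.Le.cut`). This turns the order into a notion of
embedding `LPOF.IsEmb`, which can be composed and allows for a renaming of the nodes, so that
`[α] ⊑ [β]` holds iff `α` embeds into `β` (`Pom.mk_le_mk_iff`). Embeddings preserve levels. As levels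
are finite, mutual embeddings are isomorphisms (`LPOF.IsEmb.isIso_of_isEmb`), and pomsets form a
poset.

Linearization is monotone along embeddings of finite LPOFs (`linLPO_le`): the two schedulers have the
same nodes to choose from, until one of them is labelled `⊥` in the smaller LPOF. Applied to
isomorphisms this gives independence of the representative, and applied to arbitrary embeddings the
monotonicity on finite pomsets.

The truncation of `α` at level `n` keeps the nodes of level at most `n`, with `⊥` at level `n`.
Truncations are finite, lie below `α`, and every finite pomset below `[α]` lies below one of them
(`Pom.exists_le_trunc`). Hence the finite approximations of a pomset are directed, and the suprema
that define the linearization exist. By Kőnig's lemma, `[α] ⊑ [β]` as soon as this holds for all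
truncations (`LPOF.exists_isEmb_of_forall_trunc`).

In a finitely preceded dcpo all ascending chains are finite, and the same holds for the labels. In a
directed set of pomsets, the truncations at a given level are therefore eventually constant
(`LPOF.exists_isStable`): when the labels up to level `n` are final, so are the nodes of level
`n + 1`. The eventual truncations are those of a single LPOF (`LPOF.exists_forall_trunc_eq`), whose
class is the supremum (`Pom.exists_isLUB`). A finite pomset below the supremum lies below one of its
truncations and thus below a member of the directed set, which gives Scott continuity.
-/

/-! ### Renaming of formulae -/

namespace Formula

variable {Node : Type*}

theorem holds_rename (f : Node → Node) (v : Node → Bool) (ψ : Formula Node) :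
    (ψ.rename f).Holds v ↔ ψ.Holds (fun x => v (f x)) := by
  induction ψ <;> simp_all [rename, Holds]

theorem holds_congr {v w : Node → Bool} (ψ : Formula Node) (h : ∀ x ∈ ψ.free, v x = w x) :
    ψ.Holds v ↔ ψ.Holds w := by
  induction ψ with
  | tru => exact Iff.rfl
  | fls => exact Iff.rfl
  | and ψ χ h₁ h₂ =>
    exact and_congr (h₁ fun x hx => h x (Or.inl hx)) (h₂ fun x hx => h x (Or.inr hx))
  | or ψ χ h₁ h₂ =>
    exact or_congr (h₁ fun x hx => h x (Or.inl hx)) (h₂ fun x hx => h x (Or.inr hx))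
  | not ψ h₁ => exact not_congr (h₁ h)
  | var x => simp only [Holds]; rw [h x rfl]

theorem free_rename (f : Node → Node) (ψ : Formula Node) : (ψ.rename f).free = f '' ψ.free := by
  induction ψ <;> simp_all [rename, free, image_union]

/-- A valuation of the variables in `N` can be carried along a map that is injective on `N`. -/
theorem exists_valuation_comp {f : Node → Node} {N : Set Node} (hf : InjOn f N) (v : Node → Bool) :
    ∃ w : Node → Bool, ∀ x ∈ N, w (f x) = v x := by
  classical
  refine ⟨fun y => if h : ∃ x ∈ N, f x = y then v h.choose else false, fun x hx => ?_⟩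
  have h : ∃ x' ∈ N, f x' = f x := ⟨x, hx, rfl⟩
  beta_reduce
  rw [dif_pos h, hf h.choose_spec.1 hx h.choose_spec.2]

theorem Sat.rename {f : Node → Node} {ψ : Formula Node} (hf : InjOn f ψ.free) (h : ψ.Sat) :
    (ψ.rename f).Sat := by
  obtain ⟨v, hv⟩ := h
  obtain ⟨w, hw⟩ := exists_valuation_comp hf v
  exact ⟨w, (holds_rename f w ψ).2 ((holds_congr ψ hw).2 hv)⟩

theorem implies_rename_iff {f : Node → Node} {N : Set Node} (hf : InjOn f N) {ψ χ : Formula Node}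
    (hψ : ψ.free ⊆ N) (hχ : χ.free ⊆ N) :
    (ψ.rename f).Implies (χ.rename f) ↔ ψ.Implies χ := by
  constructor
  · intro h v hv
    obtain ⟨w, hw⟩ := exists_valuation_comp hf v
    have := h w ((holds_rename f w ψ).2 ((holds_congr ψ fun x hx => hw x (hψ hx)).2 hv))
    exact (holds_congr χ fun x hx => hw x (hχ hx)).1 ((holds_rename f w χ).1 this)
  · intro h v hv
    exact (holds_rename f v χ).2 (h _ ((holds_rename f v ψ).1 hv))

theorem rename_literal (f : Node → Node) (x : Node) (b : Bool) :
    (literal x b).rename f = literal (f x) b := by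
  cases b <;> rfl

theorem free_literal (x : Node) (b : Bool) : (literal x b).free = {x} := by
  cases b <;> rfl

end Formula

/-! ### Levels as ranks -/

namespace NodeOrder

variable {Node : Type*} {N : Set Node} {lt : Node → Node → Prop}

/-- `lt` is a strict order on `N` in which every node has finitely many predecessors. -/
structure FinitaryOn (N : Set Node) (lt : Node → Node → Prop) : Prop where
  mem_of_lt : ∀ x y, lt x y → x ∈ N ∧ y ∈ N
  irrefl : ∀ x, ¬ lt x x
  trans : ∀ x y z, lt x y → lt y z → lt x z
  finite : ∀ x ∈ N, (predPlus lt x).Finite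

/-- `ℓ` is strictly monotone, and takes no value at a node without taking the preceding one below
that node. Only one function on `N` has these properties, and `level` is that function. -/
structure IsRank (N : Set Node) (lt : Node → Node → Prop) (ℓ : Node → ℕ) : Prop where
  strictMono : ∀ x y, lt x y → ℓ x < ℓ y
  exists_lt : ∀ y ∈ N, ∀ m, ℓ y = m + 1 → ∃ x, lt x y ∧ ℓ x = m

theorem IsRank.eqOn {ℓ ℓ' : Node → ℕ} (hN : ∀ x y, lt x y → x ∈ N) (h : IsRank N lt ℓ)
    (h' : IsRank N lt ℓ') : EqOn ℓ ℓ' N := by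
  suffices H : ∀ n, ∀ x ∈ N, (ℓ x ≤ n → ℓ x = ℓ' x) from fun x hx => H _ x hx le_rfl
  intro n
  induction n with
  | zero =>
    intro x hx h0
    rcases hm : ℓ' x with _ | m
    · omega
    · obtain ⟨y, hy, -⟩ := h'.exists_lt x hx m hm
      have := h.strictMono y x hy
      omega
  | succ n ih =>
    intro x hx hn
    have h₁ : ℓ x ≤ ℓ' x := by
      rcases hm : ℓ x with _ | m
      · omega
      · obtain ⟨y, hy, hym⟩ := h.exists_lt x hx m hm
        have := ih y (hN y x hy) (by omega)
        have := h'.strictMono y x hy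
        omega
    have h₂ : ℓ' x ≤ ℓ x := by
      rcases hm : ℓ' x with _ | m
      · omega
      · obtain ⟨y, hy, hym⟩ := h'.exists_lt x hx m hm
        have h3 := h.strictMono y x hy
        have := ih y (hN y x hy) (by omega)
        omega
    omega

namespace FinitaryOn

theorem ncard_lt (h : FinitaryOn N lt) {x y : Node} (hxy : lt x y) :
    (predPlus lt x).ncard < (predPlus lt y).ncard :=
  ncard_lt_ncard ⟨fun _ hz => h.trans _ _ _ hz hxy, fun hs => h.irrefl x (hs hxy)⟩
    (h.finite y (h.mem_of_lt _ _ hxy).2)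

/-- Below `y`, every predecessor lies weakly below an immediate one. -/
theorem exists_succ (h : FinitaryOn N lt) {x y : Node} (hxy : lt x y) :
    ∃ z, y ∈ succ lt z ∧ (x = z ∨ lt x z) := by
  obtain ⟨z, ⟨hz, hxz⟩, hmax⟩ := exists_max_image {z | lt z y ∧ (x = z ∨ lt x z)}
    (fun z => (predPlus lt z).ncard)
    ((h.finite y (h.mem_of_lt _ _ hxy).2).subset fun z hz => hz.1) ⟨x, hxy, Or.inl rfl⟩
  refine ⟨z, ⟨hz, fun ⟨w, hzw, hwy⟩ => ?_⟩, hxz⟩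
  have := hmax w ⟨hwy, Or.inr (hxz.elim (fun e => e ▸ hzw) fun e => h.trans _ _ _ e hzw)⟩
  have := h.ncard_lt hzw
  omega

/-- Above `x`, every successor lies weakly above an immediate one. -/
theorem exists_succ' (h : FinitaryOn N lt) {x y : Node} (hxy : lt x y) :
    ∃ z ∈ succ lt x, z = y ∨ lt z y := by
  obtain ⟨z, ⟨hz, hzy⟩, hmin⟩ := exists_min_image {z | lt x z ∧ (z = y ∨ lt z y)}
    (fun z => (predPlus lt z).ncard)
    (((h.finite y (h.mem_of_lt _ _ hxy).2).insert y).subset fun z hz => hz.2) ⟨y, hxy, Or.inl rfl⟩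
  refine ⟨z, ⟨hz, fun ⟨w, hxw, hwz⟩ => ?_⟩, hzy⟩
  have := hmin w ⟨hxw, Or.inr (hzy.elim (fun e => e ▸ hwz) fun e => h.trans _ _ _ hwz e)⟩
  have := h.ncard_lt hwz
  omega

theorem mem_min_iff (h : FinitaryOn N lt) {x : Node} : x ∈ min N lt ↔ x ∈ N ∧ ∀ y, ¬ lt y x := by
  refine and_congr_right fun _ => ⟨fun hp y hy => ?_, fun hp => ?_⟩
  · obtain ⟨z, hz, -⟩ := h.exists_succ hy
    have : z ∈ pred lt x := hz
    rw [hp] at this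
    exact this
  · exact eq_empty_of_forall_notMem fun y hy => hp y hy.1

end FinitaryOn

/-- There is a path of `n` immediate successors from a minimal node to `x`. -/
def HasPath (N : Set Node) (lt : Node → Node → Prop) (x : Node) (n : ℕ) : Prop :=
  ∃ c : ℕ → Node, c 0 ∈ min N lt ∧ c n = x ∧ ∀ i < n, c (i + 1) ∈ succ lt (c i)

theorem HasPath.step {x y : Node} {n : ℕ} (h : HasPath N lt x n) (hy : y ∈ succ lt x) :
    HasPath N lt y (n + 1) := by
  obtain ⟨c, h0, hn, hs⟩ := h
  refine ⟨fun i => if i ≤ n then c i else y, by simpa using h0, by simp, fun i hi => ?_⟩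
  rcases Nat.lt_or_ge i n with hin | hin
  · simpa [hin.le, Nat.succ_le_of_lt hin] using hs i hin
  · obtain rfl : i = n := by omega
    simpa [hn] using hy

theorem HasPath.exists_of_succ {y : Node} {n : ℕ} (h : HasPath N lt y (n + 1)) :
    ∃ x, HasPath N lt x n ∧ y ∈ succ lt x := by
  obtain ⟨c, h0, hn, hs⟩ := h
  exact ⟨c n, ⟨c, h0, rfl, fun i hi => hs i (by omega)⟩, hn ▸ hs n (by omega)⟩

namespace FinitaryOn

theorem le_ncard_of_hasPath (h : FinitaryOn N lt) {n : ℕ} :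
    ∀ {x : Node}, HasPath N lt x n → n ≤ (predPlus lt x).ncard := by
  induction n with
  | zero => intro x _; exact Nat.zero_le _
  | succ n ih =>
    intro x hx
    obtain ⟨y, hy, hyx⟩ := hx.exists_of_succ
    have := ih hy
    have := h.ncard_lt hyx.1
    omega

theorem exists_hasPath (h : FinitaryOn N lt) {x : Node} (hx : x ∈ N) : ∃ n, HasPath N lt x n := by
  induction hk : (predPlus lt x).ncard using Nat.strong_induction_on generalizing x with
  | _ k ih =>
    by_cases hm : x ∈ min N lt
    · exact ⟨0, fun _ => x, hm, rfl, fun i hi => absurd hi (Nat.not_lt_zero _)⟩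
    · have : ∃ y, lt y x := by
        by_contra hc
        exact hm (h.mem_min_iff.2 ⟨hx, fun y hy => hc ⟨y, hy⟩⟩)
      obtain ⟨y, hy⟩ := this
      obtain ⟨z, hz, -⟩ := h.exists_succ hy
      obtain ⟨n, hn⟩ := ih _ (hk ▸ h.ncard_lt hz.1) (h.mem_of_lt _ _ hz.1).1 rfl
      exact ⟨n + 1, hn.step hz⟩

theorem bddAbove_hasPath (h : FinitaryOn N lt) (x : Node) : BddAbove {n | HasPath N lt x n} :=
  ⟨_, fun _ hn => h.le_ncard_of_hasPath hn⟩

theorem hasPath_level (h : FinitaryOn N lt) {x : Node} (hx : x ∈ N) :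
    HasPath N lt x (level N lt x) :=
  Nat.sSup_mem (s := {n | HasPath N lt x n}) (h.exists_hasPath hx) (h.bddAbove_hasPath x)

theorem le_level (h : FinitaryOn N lt) {x : Node} {n : ℕ} (hn : HasPath N lt x n) :
    n ≤ level N lt x :=
  le_csSup (h.bddAbove_hasPath x) hn

theorem level_lt_of_succ (h : FinitaryOn N lt) {x y : Node} (hy : y ∈ succ lt x) :
    level N lt x < level N lt y :=
  h.le_level ((h.hasPath_level (h.mem_of_lt _ _ hy.1).1).step hy)

theorem level_lt (h : FinitaryOn N lt) {x y : Node} (hxy : lt x y) :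
    level N lt x < level N lt y := by
  induction hk : (predPlus lt y).ncard using Nat.strong_induction_on generalizing y with
  | _ k ih =>
    obtain ⟨z, hz, rfl | hxz⟩ := h.exists_succ hxy
    · exact h.level_lt_of_succ hz
    · exact (ih _ (hk ▸ h.ncard_lt hz.1) hxz rfl).trans (h.level_lt_of_succ hz)

theorem isRank_level (h : FinitaryOn N lt) : IsRank N lt (level N lt) where
  strictMono _ _ := h.level_lt
  exists_lt y hy m hm := by
    obtain ⟨x, hx, hxy⟩ := (hm ▸ h.hasPath_level hy).exists_of_succ
    have := h.le_level hx
    have := h.level_lt hxy.1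
    exact ⟨x, hxy.1, by omega⟩

theorem level_eq (h : FinitaryOn N lt) {ℓ : Node → ℕ} (hℓ : IsRank N lt ℓ) :
    EqOn (level N lt) ℓ N :=
  h.isRank_level.eqOn (fun _ _ hxy => (h.mem_of_lt _ _ hxy).1) hℓ

end FinitaryOn

theorem IsRank.finite_predPlus {ℓ : Node → ℕ} (h : IsRank N lt ℓ)
    (hN : ∀ x y, lt x y → x ∈ N ∧ y ∈ N) (hfin : ∀ n, {x ∈ N | ℓ x = n}.Finite) (x : Node) :
    (predPlus lt x).Finite := by
  refine ((finite_Iio (ℓ x)).biUnion fun n _ => hfin n).subset fun y hy => ?_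
  exact mem_biUnion (h.strictMono y x hy) ⟨(hN _ _ hy).1, rfl⟩

end NodeOrder

namespace LPOF

open NodeOrder

variable {Node L : Type*} [PartialOrder L] [OrderBot L]

theorem finitaryOn (α : LPOF Node L) : FinitaryOn α.nodes α.lt :=
  ⟨α.mem_of_lt, α.lt_irrefl, α.lt_trans, α.finitely_preceded⟩

/-- The level of a node of `α`. -/
noncomputable def lev (α : LPOF Node L) (x : Node) : ℕ := level α.nodes α.lt x

theorem isRank_lev (α : LPOF Node L) : IsRank α.nodes α.lt α.lev := α.finitaryOn.isRank_level

theorem lev_lt (α : LPOF Node L) {x y : Node} (h : α.lt x y) : α.lev x < α.lev y :=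
  α.isRank_lev.strictMono x y h

/-- Below a node there are nodes of every smaller level. -/
theorem exists_lt_of_lt_lev (α : LPOF Node L) {y : Node} (hy : y ∈ α.nodes) {m : ℕ}
    (hm : m < α.lev y) : ∃ x, α.lt x y ∧ α.lev x = m := by
  induction hk : α.lev y generalizing y with
  | zero => omega
  | succ k ih =>
    obtain ⟨x, hxy, hx⟩ := α.isRank_lev.exists_lt y hy k hk
    rcases Nat.lt_or_ge m k with hmk | hmk
    · obtain ⟨z, hz, hzm⟩ := ih (α.mem_of_lt _ _ hxy).1 (by omega) hx
      exact ⟨z, α.lt_trans _ _ _ hz hxy, hzm⟩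
    · exact ⟨x, hxy, by omega⟩

theorem lev_eq_zero_iff (α : LPOF Node L) {x : Node} (hx : x ∈ α.nodes) :
    α.lev x = 0 ↔ x ∈ min α.nodes α.lt := by
  rw [α.finitaryOn.mem_min_iff]
  refine ⟨fun h => ⟨hx, fun y hy => ?_⟩, fun h => ?_⟩
  · have := α.lev_lt hy
    omega
  · rcases hm : α.lev x with _ | m
    · rfl
    · obtain ⟨y, hy, -⟩ := α.isRank_lev.exists_lt x hx m hm
      exact absurd hy (h.2 y)

theorem exists_root (α : LPOF Node L) : ∃ r ∈ α.nodes, α.lev r = 0 ∧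
    ∀ x ∈ α.nodes, α.lev x = 0 → x = r := by
  obtain ⟨r, hr, hu⟩ := α.single_rooted
  exact ⟨r, hr.1, (α.lev_eq_zero_iff hr.1).2 hr, fun x hx h => hu x ((α.lev_eq_zero_iff hx).1 h)⟩

theorem finite_lev_le (α : LPOF Node L) (n : ℕ) : {x ∈ α.nodes | α.lev x ≤ n}.Finite := by
  refine ((finite_Iic n).biUnion fun k _ => α.finite_level k).subset fun x hx => ?_
  exact mem_biUnion (mem_Iic.2 hx.2) ⟨hx.1, rfl⟩

theorem not_lt_of_label_eq_bot (α : LPOF Node L) {x y : Node} (h : α.label x = ⊥) : ¬ α.lt x y := by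
  intro hxy
  obtain ⟨z, hz, -⟩ := α.finitaryOn.exists_succ' hxy
  rw [α.succ_of_bot x (α.mem_of_lt _ _ hxy).1 h] at hz
  exact hz

/-- The LPOF given by an order with a rank function: the rank takes care of countability, finite
precedence, and the conditions on levels and minimal nodes. -/
def ofRank (nodes : Set Node) (lt : Node → Node → Prop) (label : Node → L)
    (formula : Node → Formula Node) (ℓ : Node → ℕ)
    (mem_of_lt : ∀ x y, lt x y → x ∈ nodes ∧ y ∈ nodes)
    (lt_trans : ∀ x y z, lt x y → lt y z → lt x z)
    (hℓ : IsRank nodes lt ℓ) (finite_level : ∀ n, {x ∈ nodes | ℓ x = n}.Finite)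
    (root : ∃! x, x ∈ nodes ∧ ℓ x = 0)
    (not_lt_of_bot : ∀ x y, label x = ⊥ → ¬ lt x y)
    (formula_sat : ∀ x ∈ nodes, (formula x).Sat)
    (formula_free : ∀ x ∈ nodes, (formula x).free ⊆ predPlus lt x)
    (formula_implies : ∀ x y, lt x y → (formula y).Implies (formula x)) : LPOF Node L :=
  have lt_irrefl : ∀ x, ¬ lt x x := fun x h => Nat.lt_irrefl _ (hℓ.strictMono x x h)
  have fin : FinitaryOn nodes lt :=
    ⟨mem_of_lt, lt_irrefl, lt_trans, fun x _ => hℓ.finite_predPlus mem_of_lt finite_level x⟩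
  { nodes, lt, label, formula, mem_of_lt, lt_irrefl, lt_trans, formula_sat, formula_free
    formula_implies
    nodes_countable := by
      refine (countable_iUnion fun n => (finite_level n).countable).mono fun x hx => ?_
      exact mem_iUnion.2 ⟨ℓ x, hx, rfl⟩
    finitely_preceded := fin.finite
    finite_level := fun n => by
      refine (finite_level n).subset fun x hx => ⟨hx.1, ?_⟩
      rw [← fin.level_eq hℓ hx.1]; exact hx.2
    single_rooted := by
      have key : ∀ x, x ∈ min nodes lt ↔ x ∈ nodes ∧ ℓ x = 0 := by
        intro x
        rw [fin.mem_min_iff]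
        refine and_congr_right fun hx => ⟨fun h => ?_, fun h y hy => ?_⟩
        · rcases hm : ℓ x with _ | m
          · rfl
          · obtain ⟨y, hy, -⟩ := hℓ.exists_lt x hx m hm
            exact absurd hy (h y)
        · have := hℓ.strictMono y x hy
          omega
      simpa only [key] using root
    succ_of_bot := fun x _ h => eq_empty_of_forall_notMem fun y hy => not_lt_of_bot x y h hy.1 }

end LPOF

/-! ### Embeddings of LPOFs -/

namespace LPOF

open NodeOrder

variable {Node L : Type*} [PartialOrder L] [OrderBot L]

theorem mem_left (α : LPOF Node L) {x y : Node} (h : α.lt x y) : x ∈ α.nodes :=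
  (α.mem_of_lt x y h).1

theorem mem_right (α : LPOF Node L) {x y : Node} (h : α.lt x y) : y ∈ α.nodes :=
  (α.mem_of_lt x y h).2

/-- `f` identifies `α` with an LPOF below `β`. The condition on immediate successors in the order
of LPOFs is replaced by `cut`: whatever `β` has in addition to `α` lies above a node that `α`
labels with `⊥`. -/
structure IsEmb (α β : LPOF Node L) (f : Node → Node) : Prop where
  mapsTo : MapsTo f α.nodes β.nodes
  injOn : InjOn f α.nodes
  lt_iff : ∀ x ∈ α.nodes, ∀ y ∈ α.nodes, α.lt x y ↔ β.lt (f x) (f y)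
  down_closed : ∀ x ∈ α.nodes, ∀ y, β.lt y (f x) → y ∈ f '' α.nodes
  label_le : ∀ x ∈ α.nodes, α.label x ≤ β.label (f x)
  formula_eq : ∀ x ∈ α.nodes, β.formula (f x) = (α.formula x).rename f
  cut : ∀ y ∈ β.nodes, y ∉ f '' α.nodes → ∃ z ∈ α.botNodes, β.lt (f z) y

variable {α β γ : LPOF Node L} {f g : Node → Node}

theorem IsEmb.map_lt (h : IsEmb α β f) {x y : Node} (hxy : α.lt x y) : β.lt (f x) (f y) :=
  (h.lt_iff x (α.mem_left hxy) y (α.mem_right hxy)).1 hxy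

theorem IsEmb.congr (h : IsEmb α β f) (hfg : EqOn f g α.nodes) : IsEmb α β g := by
  have himg : g '' α.nodes = f '' α.nodes := image_congr fun x hx => (hfg hx).symm
  refine ⟨h.mapsTo.congr hfg, h.injOn.congr hfg, ?_, ?_, ?_, ?_, ?_⟩
  · intro x hx y hy
    rw [← hfg hx, ← hfg hy]; exact h.lt_iff x hx y hy
  · intro x hx y
    rw [← hfg hx, himg]; exact h.down_closed x hx y
  · intro x hx
    rw [← hfg hx]; exact h.label_le x hx
  · intro x hx
    rw [← hfg hx, h.formula_eq x hx]
    exact Formula.rename_congr _ fun y hy => hfg (α.formula_free_subset hx hy)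
  · intro y hy
    rw [himg]
    intro hy'
    obtain ⟨z, hz, hzy⟩ := h.cut y hy hy'
    exact ⟨z, hz, hfg hz.1 ▸ hzy⟩

theorem IsEmb.comp (hg : IsEmb β γ g) (hf : IsEmb α β f) : IsEmb α γ (g ∘ f) := by
  refine ⟨hg.mapsTo.comp hf.mapsTo, hg.injOn.comp hf.injOn hf.mapsTo, ?_, ?_, ?_, ?_, ?_⟩
  · intro x hx y hy
    rw [hf.lt_iff x hx y hy, hg.lt_iff _ (hf.mapsTo hx) _ (hf.mapsTo hy)]; rfl
  · intro x hx y hy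
    obtain ⟨y, hy', rfl⟩ := hg.down_closed _ (hf.mapsTo hx) y hy
    obtain ⟨y, hy'', rfl⟩ := hf.down_closed x hx y ((hg.lt_iff _ hy' _ (hf.mapsTo hx)).2 hy)
    exact ⟨y, hy'', rfl⟩
  · exact fun x hx => (hf.label_le x hx).trans (hg.label_le _ (hf.mapsTo hx))
  · intro x hx
    rw [Function.comp_apply, hg.formula_eq _ (hf.mapsTo hx), hf.formula_eq x hx,
      Formula.rename_rename]
    rfl
  · intro y hy hy'
    by_cases hyg : y ∈ g '' β.nodes
    · obtain ⟨y, hyβ, rfl⟩ := hyg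
      obtain ⟨z, hz, hzy⟩ := hf.cut y hyβ fun ⟨x, hx, e⟩ => hy' ⟨x, hx, congrArg g e⟩
      exact ⟨z, hz, hg.map_lt hzy⟩
    · obtain ⟨z, hz, hzy⟩ := hg.cut y hy hyg
      by_cases hzf : z ∈ f '' α.nodes
      · obtain ⟨z, hzα, rfl⟩ := hzf
        exact ⟨z, ⟨hzα, le_bot_iff.1 (hz.2 ▸ hf.label_le z hzα)⟩, hzy⟩
      · obtain ⟨w, hw, hwz⟩ := hf.cut z hz.1 hzf
        exact ⟨w, hw, γ.lt_trans _ _ _ (hg.map_lt hwz) hzy⟩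

theorem IsEmb.lev_eq (h : IsEmb α β f) {x : Node} (hx : x ∈ α.nodes) : β.lev (f x) = α.lev x := by
  refine (α.isRank_lev.eqOn (ℓ' := fun x => β.lev (f x)) (fun _ _ h => α.mem_left h) ⟨?_, ?_⟩
    hx).symm
  · exact fun x y hxy => β.lev_lt (h.map_lt hxy)
  · intro y hy m hm
    obtain ⟨x, hxy, hx⟩ := β.isRank_lev.exists_lt _ (h.mapsTo hy) m hm
    obtain ⟨x, hxα, rfl⟩ := h.down_closed y hy x hxy
    exact ⟨x, (h.lt_iff x hxα y hy).2 hxy, hx⟩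

theorem IsEmb.refl (α : LPOF Node L) : IsEmb α α id :=
  ⟨mapsTo_id _, injOn_id _, fun _ _ _ _ => Iff.rfl, fun _ _ _ h => ⟨_, α.mem_left h, rfl⟩,
    fun _ _ => le_rfl, fun x _ => (Formula.rename_id (α.formula x)).symm,
    fun y hy hy' => absurd ⟨y, hy, rfl⟩ hy'⟩

theorem IsIso.isEmb (h : IsIso α β f) : IsEmb α β f where
  mapsTo := h.bijOn.mapsTo
  injOn := h.bijOn.injOn
  lt_iff := h.lt_iff
  down_closed _ _ _ hy := h.bijOn.surjOn (β.mem_left hy)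
  label_le x hx := (h.label_eq x hx).ge
  formula_eq := h.formula_eq
  cut _ hy hy' := absurd (h.bijOn.surjOn hy) hy'

theorem IsEmb.isIso (h : IsEmb α β f) (hs : SurjOn f α.nodes β.nodes)
    (hl : ∀ x ∈ α.nodes, β.label (f x) ≤ α.label x) : IsIso α β f where
  bijOn := ⟨h.mapsTo, h.injOn, hs⟩
  lt_iff := h.lt_iff
  label_eq x hx := (hl x hx).antisymm (h.label_le x hx)
  formula_eq := h.formula_eq

/-- A path from the root to a node outside `α` leaves `α` at an immediate successor, which the
condition on immediate successors places above a node labelled `⊥`. -/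
theorem Le.cut (h : Le α β) {y : Node} (hy : y ∈ β.nodes) (hyα : y ∉ α.nodes) :
    ∃ z ∈ α.botNodes, β.lt z y := by
  induction hk : β.lev y using Nat.strong_induction_on generalizing y with
  | _ k ih =>
    have : ∃ x, β.lt x y := by
      rcases hm : β.lev y with _ | m
      -- the root of `α` has no predecessors in `β` either, so it is also the root of `β`
      · obtain ⟨r, -, -, hu⟩ := β.exists_root
        obtain ⟨s, hs, hs0, -⟩ := α.exists_root
        have hsβ : β.lev s = 0 := by
          rw [β.lev_eq_zero_iff (h.nodes_subset hs), β.finitaryOn.mem_min_iff]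
          refine ⟨h.nodes_subset hs, fun z hz => ?_⟩
          have := α.lev_lt ((h.lt_iff z s).2 ⟨hz, h.down_closed s hs hz, hs⟩)
          omega
        exact absurd ((hu s (h.nodes_subset hs) hsβ).trans (hu y hy hm).symm ▸ hs) hyα
      · obtain ⟨x, hx, -⟩ := β.isRank_lev.exists_lt y hy m hm
        exact ⟨x, hx⟩
    obtain ⟨x, hx⟩ := this
    obtain ⟨z, hz, -⟩ := β.finitaryOn.exists_succ hx
    by_cases hzα : z ∈ α.nodes
    · by_contra hc
      have : y ∈ succ α.lt z := by
        rw [h.succ_eq z hzα]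
        refine ⟨hz, fun hu => hc ?_⟩
        obtain ⟨w, hw, hwy⟩ := mem_iUnion₂.1 hu
        exact ⟨w, hw, hwy⟩
      exact hyα (α.mem_right this.1)
    · obtain ⟨w, hw, hwz⟩ := ih _ (hk ▸ β.lev_lt hz.1) (β.mem_left hz.1) hzα rfl
      exact ⟨w, hw, β.lt_trans _ _ _ hwz hz.1⟩

theorem Le.isEmb (h : Le α β) : IsEmb α β id where
  mapsTo := h.nodes_subset
  injOn := injOn_id _
  lt_iff x hx y hy := by rw [h.lt_iff]; simp [hx, hy]
  down_closed x hx y hy := ⟨y, h.down_closed x hx hy, rfl⟩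
  label_le := h.label_le
  formula_eq x hx := (h.formula_eq x hx).symm.trans (Formula.rename_id _).symm
  cut y hy hy' := h.cut hy (by simpa using hy')

theorem IsEmb.le (h : IsEmb α β id) : Le α β where
  nodes_subset := h.mapsTo
  down_closed y hy x hx := by simpa using h.down_closed y hy x hx
  lt_iff x y := ⟨fun hxy => ⟨h.map_lt hxy, α.mem_left hxy, α.mem_right hxy⟩,
    fun ⟨hxy, hx, hy⟩ => (h.lt_iff x hx y hy).2 hxy⟩
  label_le := h.label_le
  formula_eq x hx := ((h.formula_eq x hx).trans (Formula.rename_id _)).symm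
  succ_eq x hx := by
    ext y
    constructor
    · rintro ⟨hxy, hi⟩
      refine ⟨⟨h.map_lt hxy, fun ⟨z, hxz, hzy⟩ => ?_⟩, fun hu => ?_⟩
      · obtain ⟨z, hz, rfl⟩ := h.down_closed y (α.mem_right hxy) z hzy
        exact hi ⟨z, (h.lt_iff x hx z hz).2 hxz, (h.lt_iff z hz y (α.mem_right hxy)).2 hzy⟩
      · obtain ⟨w, hw, hwy⟩ := mem_iUnion₂.1 hu
        exact α.not_lt_of_label_eq_bot hw.2 ((h.lt_iff w hw.1 y (α.mem_right hxy)).2 hwy)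
    · rintro ⟨⟨hxy, hi⟩, hu⟩
      have hy : y ∈ α.nodes := by
        by_contra hc
        obtain ⟨z, hz, hzy⟩ := h.cut y (β.mem_right hxy) (by simpa using hc)
        exact hu (mem_iUnion₂.2 ⟨z, hz, hzy⟩)
      exact ⟨(h.lt_iff x hx y hy).2 hxy,
        fun ⟨z, hxz, hzy⟩ => hi ⟨z, h.map_lt hxz, h.map_lt hzy⟩⟩

theorem IsIso.congr (h : IsIso α β f) (hfg : EqOn f g α.nodes) : IsIso α β g := by
  refine (h.isEmb.congr hfg).isIso (h.bijOn.surjOn.congr hfg) fun x hx => ?_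
  rw [← hfg hx, h.label_eq x hx]

theorem IsIso.comp (hg : IsIso β γ g) (hf : IsIso α β f) : IsIso α γ (g ∘ f) := by
  refine (hg.isEmb.comp hf.isEmb).isIso (hg.bijOn.surjOn.comp hf.bijOn.surjOn) fun x hx => ?_
  rw [Function.comp_apply, hg.label_eq _ (hf.bijOn.mapsTo hx), hf.label_eq x hx]

/-! ### Transport along an injection -/

/-- The LPOF that is carried over from `α` along a map that is injective on the nodes. -/
noncomputable def map (α : LPOF Node L) (f : Node → Node) (hf : InjOn f α.nodes) : LPOF Node L :=
  haveI : Nonempty Node := ⟨α.single_rooted.choose⟩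
  let g := Function.invFunOn f α.nodes
  have hg : ∀ x ∈ α.nodes, g (f x) = x := fun x hx => hf.leftInvOn_invFunOn hx
  ofRank (f '' α.nodes) (Relation.Map α.lt f f) (fun y => α.label (g y))
    (fun y => (α.formula (g y)).rename f) (fun y => α.lev (g y))
    (by
      rintro _ _ ⟨x, y, h, rfl, rfl⟩
      exact ⟨⟨x, α.mem_left h, rfl⟩, ⟨y, α.mem_right h, rfl⟩⟩)
    (by
      rintro _ _ _ ⟨x, y, h, rfl, rfl⟩ ⟨y', z, h', e, rfl⟩
      obtain rfl := hf (α.mem_left h') (α.mem_right h) e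
      exact ⟨x, z, α.lt_trans _ _ _ h h', rfl, rfl⟩)
    (by
      refine ⟨?_, ?_⟩
      · rintro _ _ ⟨x, y, h, rfl, rfl⟩
        rw [hg _ (α.mem_left h), hg _ (α.mem_right h)]
        exact α.lev_lt h
      · rintro _ ⟨y, hy, rfl⟩ m hm
        rw [hg _ hy] at hm
        obtain ⟨x, hx, hxm⟩ := α.isRank_lev.exists_lt y hy m hm
        exact ⟨f x, ⟨x, y, hx, rfl, rfl⟩, by rw [hg _ (α.mem_left hx), hxm]⟩)
    (by
      intro n
      refine ((α.finite_level n).image f).subset ?_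
      rintro _ ⟨⟨x, hx, rfl⟩, h⟩
      rw [hg _ hx] at h
      exact ⟨x, ⟨hx, h⟩, rfl⟩)
    (by
      obtain ⟨r, hr, hr0, hu⟩ := α.exists_root
      refine ⟨f r, ⟨⟨r, hr, rfl⟩, by rw [hg r hr, hr0]⟩, ?_⟩
      rintro _ ⟨⟨x, hx, rfl⟩, h⟩
      rw [hg _ hx] at h
      rw [hu x hx h])
    (by
      rintro _ _ hb ⟨x, y, h, rfl, rfl⟩
      rw [hg _ (α.mem_left h)] at hb
      exact α.not_lt_of_label_eq_bot hb h)
    (by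
      rintro _ ⟨x, hx, rfl⟩
      rw [hg _ hx]
      exact (α.formula_sat x hx).rename (hf.mono (α.formula_free_subset hx)))
    (by
      rintro _ ⟨x, hx, rfl⟩
      rw [hg _ hx, Formula.free_rename]
      rintro _ ⟨y, hy, rfl⟩
      exact ⟨y, x, α.formula_free x hx hy, rfl, rfl⟩)
    (by
      rintro _ _ ⟨x, y, h, rfl, rfl⟩
      rw [hg _ (α.mem_left h), hg _ (α.mem_right h),
        Formula.implies_rename_iff hf (α.formula_free_subset (α.mem_right h))
          (α.formula_free_subset (α.mem_left h))]
      exact α.formula_implies x y h)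

theorem isIso_map (α : LPOF Node L) (f : Node → Node) (hf : InjOn f α.nodes) :
    IsIso α (α.map f hf) f := by
  have : Nonempty Node := ⟨α.single_rooted.choose⟩
  have hg : ∀ x ∈ α.nodes, Function.invFunOn f α.nodes (f x) = x :=
    fun x hx => hf.leftInvOn_invFunOn hx
  refine ⟨hf.bijOn_image, ?_, ?_, ?_⟩
  · intro x hx y hy
    refine ⟨fun h => ⟨x, y, h, rfl, rfl⟩, ?_⟩
    rintro ⟨x', y', h, ex, ey⟩
    rwa [hf (α.mem_left h) hx ex, hf (α.mem_right h) hy ey] at h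
  · intro x hx
    exact congrArg α.label (hg x hx)
  · intro x hx
    exact congrArg (fun y => (α.formula y).rename f) (hg x hx)

theorem IsEmb.map_le (h : IsEmb α β f) : Le (α.map f h.injOn) β := by
  have hi := α.isIso_map f h.injOn
  have hn : (α.map f h.injOn).nodes = f '' α.nodes := rfl
  apply IsEmb.le
  refine ⟨?_, injOn_id _, ?_, ?_, ?_, ?_, ?_⟩
  · rw [hn]; exact h.mapsTo.image_subset
  · rintro _ ⟨x, hx, rfl⟩ _ ⟨y, hy, rfl⟩
    exact (hi.lt_iff x hx y hy).symm.trans (h.lt_iff x hx y hy)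
  · rintro _ ⟨x, hx, rfl⟩ y hy
    rw [hn, image_id]
    exact h.down_closed x hx y hy
  · rintro _ ⟨x, hx, rfl⟩
    rw [hi.label_eq x hx]
    exact h.label_le x hx
  · rintro _ ⟨x, hx, rfl⟩
    rw [hi.formula_eq x hx]
    exact (h.formula_eq x hx).trans (Formula.rename_id _).symm
  · intro y hy hy'
    rw [hn, image_id] at hy'
    obtain ⟨z, hz, hzy⟩ := h.cut y hy hy'
    exact ⟨f z, ⟨⟨z, hz.1, rfl⟩, (hi.label_eq z hz.1).trans hz.2⟩, hzy⟩

/-- Two LPOFs that embed into one another are isomorphic: the composite of the embeddings permutes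
each of the finite levels, so that every node returns to itself along increasing labels. -/
theorem IsEmb.isIso_of_isEmb (hf : IsEmb α β f) (hg : IsEmb β α g) : IsIso α β f := by
  have perm : ∀ {α : LPOF Node L} {h : Node → Node}, IsEmb α α h →
      SurjOn h α.nodes α.nodes ∧ ∀ x ∈ α.nodes, α.label (h x) ≤ α.label x := by
    intro α h hh
    have key : ∀ x ∈ α.nodes, ∃ k, h^[k + 1] x = x := by
      intro x hx
      have hmaps : MapsTo h {y ∈ α.nodes | α.lev y = α.lev x} {y ∈ α.nodes | α.lev y = α.lev x} :=
        fun y hy => ⟨hh.mapsTo hy.1, (hh.lev_eq hy.1).trans hy.2⟩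
      have hfin : Finite {y ∈ α.nodes | α.lev y = α.lev x} := (α.finite_level _).to_subtype
      have hinj := hmaps.restrict_inj.2 (hh.injOn.mono fun y hy => hy.1)
      obtain ⟨n, hn, hp⟩ := Function.mem_periodicPts.1 (hinj.mem_periodicPts ⟨x, hx, rfl⟩)
      obtain ⟨k, rfl⟩ := Nat.exists_eq_succ_of_ne_zero hn.ne'
      have := congrArg Subtype.val hp
      rw [hmaps.iterate_restrict] at this
      exact ⟨k, this⟩
    have hit : ∀ k, ∀ x ∈ α.nodes, h^[k] x ∈ α.nodes ∧ α.label x ≤ α.label (h^[k] x) := by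
      intro k
      induction k with
      | zero => exact fun x hx => ⟨hx, le_rfl⟩
      | succ k ih =>
        intro x hx
        obtain ⟨h₁, h₂⟩ := ih _ (hh.mapsTo hx)
        exact ⟨h₁, (hh.label_le x hx).trans h₂⟩
    refine ⟨fun x hx => ?_, fun x hx => ?_⟩
    · obtain ⟨k, hk⟩ := key x hx
      exact ⟨h^[k] x, (hit k x hx).1, by rw [← Function.iterate_succ_apply' h k x, hk]⟩
    · obtain ⟨k, hk⟩ := key x hx
      have := (hit k _ (hh.mapsTo hx)).2
      rwa [← Function.iterate_succ_apply, hk] at this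
  obtain ⟨hsg, -⟩ := perm (hf.comp hg)
  obtain ⟨-, hl⟩ := perm (hg.comp hf)
  refine hf.isIso (fun y hy => ?_) fun x hx => (hg.label_le _ (hf.mapsTo hx)).trans (hl x hx)
  obtain ⟨z, hz, rfl⟩ := hsg hy
  exact ⟨g z, hg.mapsTo hz, rfl⟩

end LPOF

namespace Pom

variable {Node L : Type*} [PartialOrder L] [OrderBot L]

theorem mk_eq_mk_iff {α β : LPOF Node L} : mk α = mk β ↔ ∃ f, LPOF.IsIso α β f := Quotient.eq

theorem exists_mk (A : Pom Node L) : ∃ α : LPOF Node L, mk α = A := Quotient.exists_rep A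

theorem mk_le_mk_iff {α β : LPOF Node L} : mk α ≤ mk β ↔ ∃ f, LPOF.IsEmb α β f := by
  constructor
  · rintro ⟨α', β', hα, hβ, h⟩
    obtain ⟨f, hf⟩ := mk_eq_mk_iff.1 hα.symm
    obtain ⟨g, hg⟩ := mk_eq_mk_iff.1 hβ
    exact ⟨_, hg.isEmb.comp (h.isEmb.comp hf.isEmb)⟩
  · rintro ⟨f, hf⟩
    exact ⟨α.map f hf.injOn, β, (mk_eq_mk_iff.2 ⟨f, α.isIso_map f hf.injOn⟩).symm, rfl, hf.map_le⟩

instance : PartialOrder (Pom Node L) where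
  le_refl A := by
    obtain ⟨α, rfl⟩ := exists_mk A
    exact mk_le_mk_iff.2 ⟨id, LPOF.IsEmb.refl α⟩
  le_trans A B C hAB hBC := by
    obtain ⟨α, rfl⟩ := exists_mk A
    obtain ⟨β, rfl⟩ := exists_mk B
    obtain ⟨γ, rfl⟩ := exists_mk C
    obtain ⟨f, hf⟩ := mk_le_mk_iff.1 hAB
    obtain ⟨g, hg⟩ := mk_le_mk_iff.1 hBC
    exact mk_le_mk_iff.2 ⟨_, hg.comp hf⟩
  le_antisymm A B hAB hBA := by
    obtain ⟨α, rfl⟩ := exists_mk A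
    obtain ⟨β, rfl⟩ := exists_mk B
    obtain ⟨f, hf⟩ := mk_le_mk_iff.1 hAB
    obtain ⟨g, hg⟩ := mk_le_mk_iff.1 hBA
    exact mk_eq_mk_iff.2 ⟨f, hf.isIso_of_isEmb hg⟩

end Pom

/-! ### Truncation at a level -/

namespace LPOF

open NodeOrder

variable {Node L : Type*} [PartialOrder L] [OrderBot L]

theorem eq_of_fields {α β : LPOF Node L} (hn : α.nodes = β.nodes) (hlt : α.lt = β.lt)
    (hl : α.label = β.label) (hf : α.formula = β.formula) : α = β := by
  cases α; cases β
  simp only at hn hlt hl hf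
  subst hn hlt hl hf
  rfl

open Classical in
/-- The nodes of `α` of level at most `n`, where those of level `n` are relabelled with `⊥`.
Outside of these nodes labels and formulae get fixed values, so that truncations that agree on
their nodes are equal. -/
noncomputable def trunc (n : ℕ) (α : LPOF Node L) : LPOF Node L :=
  ofRank {x ∈ α.nodes | α.lev x ≤ n} (fun x y => α.lt x y ∧ α.lev y ≤ n)
    (fun x => if x ∈ α.nodes ∧ α.lev x < n then α.label x else ⊥)
    (fun x => if x ∈ α.nodes ∧ α.lev x ≤ n then α.formula x else Formula.tru) α.lev
    (fun x y h => ⟨⟨α.mem_left h.1, (α.lev_lt h.1).le.trans h.2⟩, α.mem_right h.1, h.2⟩)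
    (fun x y z h h' => ⟨α.lt_trans _ _ _ h.1 h'.1, h'.2⟩)
    ⟨fun x y h => α.lev_lt h.1, fun y hy m hm => by
      obtain ⟨x, hx, hxm⟩ := α.isRank_lev.exists_lt y hy.1 m hm
      exact ⟨x, ⟨hx, hy.2⟩, hxm⟩⟩
    (fun k => (α.finite_level k).subset fun x hx => ⟨hx.1.1, hx.2⟩)
    (by
      obtain ⟨r, hr, hr0, hu⟩ := α.exists_root
      exact ⟨r, ⟨⟨hr, hr0 ▸ Nat.zero_le _⟩, hr0⟩, fun x hx => hu x hx.1.1 hx.2⟩)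
    (by
      intro x y hb h
      rw [if_pos ⟨α.mem_left h.1, (α.lev_lt h.1).trans_le h.2⟩] at hb
      exact α.not_lt_of_label_eq_bot hb h.1)
    (by
      intro x hx
      rw [if_pos ⟨hx.1, hx.2⟩]
      exact α.formula_sat x hx.1)
    (by
      intro x hx
      rw [if_pos ⟨hx.1, hx.2⟩]
      exact fun y hy => ⟨α.formula_free x hx.1 hy, hx.2⟩)
    (by
      intro x y h
      rw [if_pos ⟨α.mem_right h.1, h.2⟩, if_pos ⟨α.mem_left h.1, (α.lev_lt h.1).le.trans h.2⟩]
      exact α.formula_implies x y h.1)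

variable {α β γ : LPOF Node L} {f g : Node → Node} {n m : ℕ} {x y : Node}

theorem mem_trunc : x ∈ (trunc n α).nodes ↔ x ∈ α.nodes ∧ α.lev x ≤ n := Iff.rfl

theorem trunc_lt : (trunc n α).lt x y ↔ α.lt x y ∧ α.lev y ≤ n := Iff.rfl

theorem trunc_label (hx : x ∈ α.nodes) (h : α.lev x < n) : (trunc n α).label x = α.label x :=
  if_pos ⟨hx, h⟩

theorem trunc_label_of_le (h : n ≤ α.lev x) : (trunc n α).label x = ⊥ :=
  if_neg fun h' => h'.2.not_ge h

theorem trunc_label_of_notMem (h : x ∉ (trunc n α).nodes) : (trunc n α).label x = ⊥ :=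
  if_neg fun h' => h ⟨h'.1, h'.2.le⟩

theorem trunc_formula (hx : x ∈ (trunc n α).nodes) : (trunc n α).formula x = α.formula x :=
  if_pos hx

theorem trunc_formula_of_notMem (hx : x ∉ (trunc n α).nodes) :
    (trunc n α).formula x = Formula.tru :=
  if_neg hx

theorem trunc_finite (n : ℕ) (α : LPOF Node L) : (trunc n α).nodes.Finite := α.finite_lev_le n

theorem trunc_isEmb (n : ℕ) (α : LPOF Node L) : IsEmb (trunc n α) α id where
  mapsTo _ hx := hx.1
  injOn := injOn_id _
  lt_iff _ _ _ hy := ⟨fun h => h.1, fun h => ⟨h, hy.2⟩⟩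
  down_closed x hx y hy := ⟨y, ⟨α.mem_left hy, (α.lev_lt hy).le.trans hx.2⟩, rfl⟩
  label_le x hx := by
    rcases lt_or_ge (α.lev x) n with h | h
    · exact (trunc_label hx.1 h).le
    · exact trunc_label_of_le h ▸ bot_le
  formula_eq x hx := by rw [trunc_formula hx]; exact (Formula.rename_id _).symm
  cut y hy hy' := by
    -- a node above level `n` has a predecessor of level exactly `n`, which carries `⊥`
    obtain ⟨x, hx, hxn⟩ := α.exists_lt_of_lt_lev hy
      (lt_of_not_ge fun h => hy' ⟨y, ⟨hy, h⟩, rfl⟩ : n < α.lev y)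
    exact ⟨x, ⟨⟨α.mem_left hx, hxn.le⟩, trunc_label_of_le hxn.ge⟩, hx⟩

theorem lev_trunc (hx : x ∈ (trunc n α).nodes) : (trunc n α).lev x = α.lev x :=
  ((trunc_isEmb n α).lev_eq hx).symm

theorem trunc_trunc (h : n ≤ m) (α : LPOF Node L) : trunc n (trunc m α) = trunc n α := by
  have hmem : ∀ x, x ∈ (trunc n (trunc m α)).nodes ↔ x ∈ (trunc n α).nodes := by
    intro x
    rw [mem_trunc]
    refine ⟨fun ⟨h₁, h₂⟩ => ⟨h₁.1, lev_trunc h₁ ▸ h₂⟩, fun ⟨h₁, h₂⟩ => ?_⟩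
    have hm : x ∈ (trunc m α).nodes := ⟨h₁, h₂.trans h⟩
    exact ⟨hm, (lev_trunc hm).symm ▸ h₂⟩
  refine eq_of_fields (Set.ext hmem) ?_ ?_ ?_
  · ext x y
    refine ⟨fun h' => ⟨h'.1.1, ?_⟩, fun h' => ?_⟩
    · exact ((hmem y).1 (mem_right _ h')).2
    · exact ⟨⟨h'.1, h'.2.trans h⟩, ((hmem y).2 (mem_right _ h')).2⟩
  · ext x
    by_cases hx : x ∈ (trunc n α).nodes
    · have hm : x ∈ (trunc m α).nodes := ⟨hx.1, hx.2.trans h⟩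
      rcases lt_or_ge (α.lev x) n with hn | hn
      · rw [trunc_label hm (lev_trunc hm ▸ hn), trunc_label hx.1 hn,
          trunc_label hx.1 (hn.trans_le h)]
      · rw [trunc_label_of_le hn, trunc_label_of_le ((lev_trunc hm).symm ▸ hn)]
    · rw [trunc_label_of_notMem hx, trunc_label_of_notMem (mt (hmem x).1 hx)]
  · ext x
    by_cases hx : x ∈ (trunc n α).nodes
    · have hm : x ∈ (trunc m α).nodes := ⟨hx.1, hx.2.trans h⟩
      rw [trunc_formula hx, trunc_formula ((hmem x).2 hx), trunc_formula hm]
    · rw [trunc_formula_of_notMem hx, trunc_formula_of_notMem (mt (hmem x).1 hx)]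

theorem IsEmb.trunc (h : IsEmb α β f) (n : ℕ) : IsEmb (trunc n α) (trunc n β) f where
  mapsTo x hx := ⟨h.mapsTo hx.1, (h.lev_eq hx.1).trans_le hx.2⟩
  injOn := h.injOn.mono fun x hx => hx.1
  lt_iff x hx y hy := by rw [trunc_lt, trunc_lt, h.lev_eq hy.1, h.lt_iff x hx.1 y hy.1]
  down_closed x hx y hy := by
    obtain ⟨z, hz, rfl⟩ := h.down_closed x hx.1 y hy.1
    exact ⟨z, ⟨hz, (h.lev_eq hz).symm.trans_le (mem_left _ hy).2⟩, rfl⟩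
  label_le x hx := by
    rcases lt_or_ge (α.lev x) n with hn | hn
    · rw [trunc_label hx.1 hn, trunc_label (h.mapsTo hx.1) ((h.lev_eq hx.1).trans_lt hn)]
      exact h.label_le x hx.1
    · rw [trunc_label_of_le hn]
      exact bot_le
  formula_eq x hx := by
    rw [trunc_formula hx, trunc_formula ⟨h.mapsTo hx.1, (h.lev_eq hx.1).trans_le hx.2⟩]
    exact h.formula_eq x hx.1
  cut y hy hy' := by
    obtain ⟨z, hz, hzy⟩ := h.cut y hy.1 fun ⟨x, hx, e⟩ =>
      hy' ⟨x, ⟨hx, by rw [← h.lev_eq hx, e]; exact hy.2⟩, e⟩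
    have hlt : α.lev z < n := h.lev_eq hz.1 ▸ (β.lev_lt hzy).trans_le hy.2
    exact ⟨z, ⟨⟨hz.1, hlt.le⟩, (trunc_label hz.1 hlt).trans hz.2⟩, hzy, hy.2⟩

/-- An LPOF of bounded height that lies below `β` lies below a truncation of `β`. -/
theorem IsEmb.trunc_of_lev_lt (h : IsEmb α β f) (hα : ∀ x ∈ α.nodes, α.lev x < n) :
    IsEmb α (LPOF.trunc n β) f where
  mapsTo x hx := ⟨h.mapsTo hx, (h.lev_eq hx).trans_le (hα x hx).le⟩
  injOn := h.injOn
  lt_iff x hx y hy := by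
    rw [trunc_lt, h.lev_eq hy, h.lt_iff x hx y hy]
    exact ⟨fun h' => ⟨h', (hα y hy).le⟩, fun h' => h'.1⟩
  down_closed x hx y hy := h.down_closed x hx y hy.1
  label_le x hx := by
    rw [trunc_label (h.mapsTo hx) ((h.lev_eq hx).trans_lt (hα x hx))]
    exact h.label_le x hx
  formula_eq x hx := by
    rw [trunc_formula ⟨h.mapsTo hx, (h.lev_eq hx).trans_le (hα x hx).le⟩]
    exact h.formula_eq x hx
  cut y hy hy' := by
    obtain ⟨z, hz, hzy⟩ := h.cut y hy.1 hy'
    exact ⟨z, hz, hzy, hy.2⟩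

theorem IsIso.trunc (h : IsIso α β f) (n : ℕ) : IsIso (trunc n α) (trunc n β) f := by
  refine (h.isEmb.trunc n).isIso (fun y hy => ?_) fun x hx => ?_
  · obtain ⟨x, hx, rfl⟩ := h.bijOn.surjOn hy.1
    exact ⟨x, ⟨hx, (h.isEmb.lev_eq hx).symm.trans_le hy.2⟩, rfl⟩
  · rcases lt_or_ge (α.lev x) n with hn | hn
    · rw [trunc_label hx.1 hn, trunc_label (h.bijOn.mapsTo hx.1) (h.isEmb.lev_eq hx.1 ▸ hn),
        h.label_eq x hx.1]
    · rw [trunc_label_of_le ((h.isEmb.lev_eq hx.1).symm ▸ hn)]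
      exact bot_le

theorem trunc_eq_of_isIso_id (h : IsIso (trunc n α) (trunc n β) id) : trunc n α = trunc n β := by
  have hn : (trunc n α).nodes = (trunc n β).nodes := by
    rw [← h.bijOn.image_eq, image_id]
  refine eq_of_fields hn ?_ ?_ ?_
  · ext x y
    refine ⟨fun h' => (h.lt_iff x (mem_left _ h') y (mem_right _ h')).1 h', fun h' => ?_⟩
    exact (h.lt_iff x (hn ▸ mem_left _ h') y (hn ▸ mem_right _ h')).2 h'
  · ext x
    by_cases hx : x ∈ (trunc n α).nodes
    · exact (h.label_eq x hx).symm
    · rw [trunc_label_of_notMem hx, trunc_label_of_notMem (hn ▸ hx)]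
  · ext x
    by_cases hx : x ∈ (trunc n α).nodes
    · exact ((h.formula_eq x hx).trans (Formula.rename_id _)).symm
    · rw [trunc_formula_of_notMem hx, trunc_formula_of_notMem (hn ▸ hx)]

/-! ### Embeddings are determined by truncations -/

theorem IsEmb.of_forall_trunc (hf : ∀ n, IsEmb (LPOF.trunc n α) (LPOF.trunc n β) f) :
    IsEmb α β f := by
  have hlev : ∀ x ∈ α.nodes, β.lev (f x) = α.lev x := by
    intro x hx
    have hx' : x ∈ (LPOF.trunc (α.lev x) α).nodes := ⟨hx, le_rfl⟩
    have := (hf (α.lev x)).lev_eq hx'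
    rwa [lev_trunc hx', lev_trunc ((hf _).mapsTo hx')] at this
  have hmem : ∀ {x}, x ∈ α.nodes → x ∈ (LPOF.trunc (α.lev x) α).nodes := fun hx => ⟨hx, le_rfl⟩
  refine ⟨fun x hx => ((hf _).mapsTo (hmem hx)).1, ?_, ?_, ?_, ?_, ?_, ?_⟩
  · intro x hx y hy e
    have : α.lev x = α.lev y := by rw [← hlev x hx, ← hlev y hy, e]
    exact (hf (α.lev y)).injOn ⟨hx, this.le⟩ (hmem hy) e
  · intro x hx y hy
    have key := (hf (max (α.lev x) (α.lev y))).lt_iff x ⟨hx, le_max_left _ _⟩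
      y ⟨hy, le_max_right _ _⟩
    rw [trunc_lt, trunc_lt, hlev y hy] at key
    simpa using key
  · intro x hx y hy
    obtain ⟨z, hz, rfl⟩ := (hf _).down_closed x (hmem hx) y ⟨hy, (hlev x hx).le⟩
    exact ⟨z, hz.1, rfl⟩
  · intro x hx
    have key := (hf (α.lev x + 1)).label_le x ⟨hx, Nat.le_succ _⟩
    rwa [trunc_label hx (Nat.lt_succ_self _), trunc_label ((hf _).mapsTo (hmem hx)).1
      (hlev x hx ▸ Nat.lt_succ_self _)] at key
  · intro x hx
    have key := (hf _).formula_eq x (hmem hx)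
    rwa [trunc_formula (hmem hx), trunc_formula ((hf _).mapsTo (hmem hx))] at key
  · intro y hy hy'
    obtain ⟨z, hz, hzy⟩ := (hf (β.lev y)).cut y ⟨hy, le_rfl⟩
      fun ⟨x, hx, e⟩ => hy' ⟨x, hx.1, e⟩
    have hlt : α.lev z < β.lev y := hlev z hz.1.1 ▸ β.lev_lt hzy.1
    exact ⟨z, ⟨hz.1.1, (trunc_label hz.1.1 hlt).symm.trans hz.2⟩, hzy.1⟩

open Classical in
/-- If every truncation of `α` embeds into the one of `β`, then so does `α` into `β`. There are only
finitely many embeddings at each level, so Kőnig's lemma yields a coherent choice. -/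
theorem exists_isEmb_of_forall_trunc (h : ∀ n, ∃ f, IsEmb (trunc n α) (trunc n β) f) :
    ∃ f, IsEmb α β f := by
  -- embeddings of the truncations, made unique by being the identity outside of the nodes
  let F : ℕ → Type _ := fun n =>
    {f : Node → Node // IsEmb (trunc n α) (trunc n β) f ∧ ∀ x ∉ (trunc n α).nodes, f x = x}
  have hres : ∀ {i j : ℕ}, i ≤ j → ∀ f : Node → Node, IsEmb (trunc j α) (trunc j β) f →
      IsEmb (trunc i α) (trunc i β) f := by
    intro i j hij f hf
    have := hf.trunc i
    rwa [trunc_trunc hij, trunc_trunc hij] at this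
  have hpw : ∀ (n : ℕ) (f : Node → Node), IsEmb (trunc n α) (trunc n β) f →
      IsEmb (trunc n α) (trunc n β) (fun x => if x ∈ (trunc n α).nodes then f x else x) :=
    fun n f hf => hf.congr fun x hx => (if_pos hx).symm
  let π : ∀ {i j : ℕ}, i ≤ j → F j → F i := fun {i j} hij f =>
    ⟨fun x => if x ∈ (trunc i α).nodes then f.1 x else x,
      hpw i f.1 (hres hij f.1 f.2.1), fun x hx => if_neg hx⟩
  have hmono : ∀ {i j : ℕ}, i ≤ j → ∀ x, x ∈ (trunc i α).nodes → x ∈ (trunc j α).nodes :=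
    fun hij x hx => ⟨hx.1, hx.2.trans hij⟩
  have hfin : ∀ n, Finite (F n) := by
    intro n
    have := (trunc_finite n α).to_subtype
    have := (trunc_finite n β).to_subtype
    refine Finite.of_injective (β := (trunc n α).nodes → (trunc n β).nodes)
      (fun f x => ⟨f.1 x.1, f.2.1.mapsTo x.2⟩) fun f g hfg => Subtype.ext (funext fun x => ?_)
    by_cases hx : x ∈ (trunc n α).nodes
    · exact congrArg Subtype.val (congrFun hfg ⟨x, hx⟩)
    · rw [f.2.2 x hx, g.2.2 x hx]
  have : ∀ n, Nonempty (F n) := by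
    intro n
    obtain ⟨f, hf⟩ := h n
    exact ⟨⟨_, hpw n f hf, fun x hx => if_neg hx⟩⟩
  obtain ⟨s, hs⟩ := exists_seq_forall_proj_of_forall_finite (α := F) π
    (fun i f => Subtype.ext (funext fun x => by
      by_cases hx : x ∈ (trunc i α).nodes
      · exact if_pos hx
      · exact (if_neg hx).trans (f.2.2 x hx).symm))
    (fun i j k hij hjk f => Subtype.ext (funext fun x => by
      by_cases hx : x ∈ (trunc i α).nodes
      · simp only [π, if_pos hx, if_pos (hmono hij x hx)]
      · simp only [π, if_neg hx]))
    (fun i a => Set.toFinite _)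
  refine ⟨fun x => (s (α.lev x)).1 x, IsEmb.of_forall_trunc fun n => ?_⟩
  refine (s n).2.1.congr fun x hx => ?_
  have := congrFun (congrArg Subtype.val (hs hx.2)) x
  rw [← this]
  exact (if_pos ⟨hx.1, le_rfl⟩).symm

end LPOF

namespace Pom

variable {Node L : Type*} [PartialOrder L] [OrderBot L] {α β : LPOF Node L}

open LPOF

theorem mk_trunc_le (n : ℕ) (α : LPOF Node L) : mk (trunc n α) ≤ mk α :=
  mk_le_mk_iff.2 ⟨id, trunc_isEmb n α⟩

theorem mk_trunc_mono (n : ℕ) (h : mk α ≤ mk β) : mk (trunc n α) ≤ mk (trunc n β) := by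
  obtain ⟨f, hf⟩ := mk_le_mk_iff.1 h
  exact mk_le_mk_iff.2 ⟨f, hf.trunc n⟩

theorem le_of_forall_trunc (h : ∀ n, mk (trunc n α) ≤ mk (trunc n β)) : mk α ≤ mk β :=
  mk_le_mk_iff.2 (exists_isEmb_of_forall_trunc fun n => mk_le_mk_iff.1 (h n))

theorem exists_le_trunc (hα : α.nodes.Finite) (h : mk α ≤ mk β) :
    ∃ n, mk α ≤ mk (trunc n β) := by
  obtain ⟨f, hf⟩ := mk_le_mk_iff.1 h
  obtain ⟨n, hn⟩ := (hα.image α.lev).bddAbove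
  exact ⟨n + 1, mk_le_mk_iff.2 ⟨f, hf.trunc_of_lev_lt fun x hx =>
    Nat.lt_succ_of_le (hn (mem_image_of_mem _ hx))⟩⟩

theorem trunc_le_trunc {n m : ℕ} (h : n ≤ m) (α : LPOF Node L) :
    mk (trunc n α) ≤ mk (trunc m α) := by
  rw [← trunc_trunc h]
  exact mk_trunc_le n _

end Pom

/-! ### Limits of coherent sequences of truncations -/

namespace LPOF

open NodeOrder

variable {Node L : Type*} [PartialOrder L] [OrderBot L]

/-- A sequence in which every member is the truncation of the later ones consists of the truncations
of one LPOF, namely of the union, where a label is read off one level above its node. -/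
theorem exists_forall_trunc_eq (τ : ℕ → LPOF Node L)
    (hτ : ∀ n m, n ≤ m → trunc n (τ m) = τ n) : ∃ γ : LPOF Node L, ∀ n, trunc n γ = τ n := by
  classical
  have hmem : ∀ {n m : ℕ} {x}, n ≤ m → (x ∈ (τ n).nodes ↔ x ∈ (τ m).nodes ∧ (τ m).lev x ≤ n) := by
    intro n m x h
    rw [← hτ n m h]; rfl
  have hlt : ∀ {n m : ℕ} {x y}, n ≤ m → ((τ n).lt x y ↔ (τ m).lt x y ∧ (τ m).lev y ≤ n) := by
    intro n m x y h
    rw [← hτ n m h]; rfl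
  have hmono : ∀ {n m : ℕ} {x}, n ≤ m → x ∈ (τ n).nodes → x ∈ (τ m).nodes :=
    fun h hx => ((hmem h).1 hx).1
  have hlev' : ∀ {n m : ℕ} {x}, n ≤ m → x ∈ (τ n).nodes → (τ n).lev x = (τ m).lev x := by
    intro n m x h hx
    rw [← hτ n m h] at hx ⊢
    exact lev_trunc hx
  have hlev : ∀ {n m : ℕ} {x}, x ∈ (τ n).nodes → x ∈ (τ m).nodes → (τ n).lev x = (τ m).lev x := by
    intro n m x hn hm
    rcases le_total n m with h | h
    · exact hlev' h hn
    · exact (hlev' h hm).symm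
  -- the level of `x` is the same in all members of the sequence that contain `x`
  let ℓ : Node → ℕ := fun x => if h : ∃ n, x ∈ (τ n).nodes then (τ h.choose).lev x else 0
  have hℓ : ∀ {n : ℕ} {x}, x ∈ (τ n).nodes → (τ n).lev x = ℓ x := by
    intro n x hx
    have h : ∃ n, x ∈ (τ n).nodes := ⟨n, hx⟩
    have h' : ℓ x = (τ h.choose).lev x := dif_pos h
    rw [h', hlev hx h.choose_spec]
  have hle : ∀ {n k : ℕ} {x}, x ∈ (τ k).nodes → (x ∈ (τ n).nodes ↔ ℓ x ≤ n) := by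
    intro n k x hk
    refine ⟨fun hn => hℓ hn ▸ ((hmem le_rfl).1 hn).2, fun hn => ?_⟩
    rcases le_total n k with h | h
    · exact (hmem h).2 ⟨hk, hℓ hk ▸ hn⟩
    · exact hmono h hk
  have hltm : ∀ {n k : ℕ} {x y}, (τ k).lt x y → ℓ y ≤ n → (τ n).lt x y := by
    intro n k x y hk hn
    rcases le_total n k with h | h
    · exact (hlt h).2 ⟨hk, hℓ (mem_right _ hk) ▸ hn⟩
    · exact ((hlt h).1 hk).1
  have hlabel : ∀ {n : ℕ} {x}, x ∈ (τ n).nodes → ℓ x < n →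
      (τ n).label x = (τ (ℓ x + 1)).label x := by
    intro n x hx hn
    rw [← hτ (ℓ x + 1) n hn, trunc_label hx (hℓ hx ▸ Nat.lt_succ_self _)]
  have hform : ∀ {n : ℕ} {x}, x ∈ (τ n).nodes → (τ n).formula x = (τ (ℓ x)).formula x := by
    intro n x hx
    rw [← hτ (ℓ x) n ((hle hx).1 hx), trunc_formula ⟨hx, (hℓ hx).le⟩]
  have hrank : IsRank {x | ∃ n, x ∈ (τ n).nodes} (fun x y => ∃ n, (τ n).lt x y) ℓ := by
    refine ⟨?_, ?_⟩
    · rintro x y ⟨n, h⟩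
      rw [← hℓ (mem_left _ h), ← hℓ (mem_right _ h)]
      exact lev_lt _ h
    · rintro y ⟨n, hy⟩ m hm
      obtain ⟨x, hx, hxm⟩ := (τ n).isRank_lev.exists_lt y hy m ((hℓ hy).trans hm)
      exact ⟨x, ⟨n, hx⟩, by rw [← hℓ (mem_left _ hx), hxm]⟩
  let γ : LPOF Node L := ofRank {x | ∃ n, x ∈ (τ n).nodes} (fun x y => ∃ n, (τ n).lt x y)
    (fun x => (τ (ℓ x + 1)).label x) (fun x => (τ (ℓ x)).formula x) ℓ
    (fun x y ⟨n, h⟩ => ⟨⟨n, mem_left _ h⟩, n, mem_right _ h⟩)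
    (fun x y z ⟨n, h⟩ ⟨m, h'⟩ => by
      have hz := (hle (mem_right _ h')).1 (mem_right _ h')
      have hy := (hle (mem_right _ h)).1 (mem_right _ h)
      exact ⟨max n m, lt_trans _ _ _ _ (hltm h (hy.trans (le_max_left _ _)))
        (hltm h' (hz.trans (le_max_right _ _)))⟩)
    hrank
    (fun k => (trunc_finite k (τ k)).subset fun x ⟨⟨n, hx⟩, hk⟩ => by
      rw [hτ k k le_rfl]
      exact (hle hx).2 hk.le)
    (by
      obtain ⟨r, hr, hr0, hu⟩ := (τ 0).exists_root
      refine ⟨r, ⟨⟨0, hr⟩, (hℓ hr).symm.trans hr0⟩, fun x ⟨⟨n, hx⟩, h0⟩ => ?_⟩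
      have hx0 := (hle hx).2 h0.le
      exact hu x hx0 ((hℓ hx0).trans h0))
    (fun x y hb ⟨n, h⟩ => by
      have hy := (hle (mem_right _ h)).1 (mem_right _ h)
      have h' : (τ (max n (ℓ x + 1))).lt x y := hltm h (hy.trans (le_max_left _ _))
      rw [← hlabel (mem_left _ h') (Nat.lt_of_succ_le (le_max_right _ _))] at hb
      exact not_lt_of_label_eq_bot _ hb h')
    (fun x ⟨n, hx⟩ => formula_sat _ x ((hle hx).2 le_rfl))
    (fun x ⟨n, hx⟩ y hy => ⟨ℓ x, formula_free _ x ((hle hx).2 le_rfl) hy⟩)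
    (fun x y ⟨n, h⟩ => by
      rw [← hform (mem_left _ h), ← hform (mem_right _ h)]
      exact formula_implies _ x y h)
  have hγ : ∀ x ∈ γ.nodes, γ.lev x = ℓ x :=
    fun x hx => γ.isRank_lev.eqOn (fun _ _ h => mem_left _ h) hrank hx
  refine ⟨γ, fun n => ?_⟩
  rw [← hτ n n le_rfl]
  apply trunc_eq_of_isIso_id
  rw [hτ n n le_rfl]
  have hnode : ∀ x, x ∈ (trunc n γ).nodes ↔ x ∈ (τ n).nodes := by
    intro x
    rw [mem_trunc]
    constructor
    · rintro ⟨⟨k, hk⟩, h⟩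
      exact (hle hk).2 (hγ x ⟨k, hk⟩ ▸ h)
    · intro hx
      exact ⟨⟨n, hx⟩, hγ x ⟨n, hx⟩ ▸ (hle hx).1 hx⟩
  refine ⟨?_, ?_, ?_, ?_⟩
  · rw [Set.ext hnode]
    exact bijOn_id _
  · intro x hx y hy
    rw [trunc_lt, hγ y hy.1]
    refine ⟨fun ⟨⟨k, h⟩, hn⟩ => hltm h hn, fun h => ⟨⟨n, h⟩, ?_⟩⟩
    exact (hle (mem_right _ h)).1 (mem_right _ h)
  · intro x hx
    have hx' := (hnode x).1 hx
    rcases lt_or_ge (ℓ x) n with hn | hn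
    · rw [trunc_label hx.1 ((hγ x hx.1).trans_lt hn)]
      exact hlabel hx' hn
    · rw [trunc_label_of_le ((hγ x hx.1).symm ▸ hn), ← hτ n n le_rfl]
      exact trunc_label_of_le ((hℓ hx').symm ▸ hn)
  · intro x hx
    rw [trunc_formula hx]
    exact (hform ((hnode x).1 hx)).trans (Formula.rename_id _).symm

/-- As only finitely many nodes have level at most `n`, there are enough fresh nodes to replace `β`
by an isomorphic LPOF that has a prescribed truncation, not just one isomorphic to it. -/
theorem exists_trunc_eq_of_isIso [Infinite Node] {α β : LPOF Node L} {f : Node → Node} {n : ℕ}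
    (h : IsIso (trunc n α) (trunc n β) f) :
    ∃ β' : LPOF Node L, Pom.mk β' = Pom.mk β ∧ trunc n β' = trunc n α := by
  classical
  have : Nonempty Node := ⟨α.single_rooted.choose⟩
  set U := (trunc n α).nodes with hU
  have hinv : ∀ x ∈ U, Function.invFunOn f U (f x) = x :=
    fun x hx => h.bijOn.injOn.leftInvOn_invFunOn hx
  -- `g` undoes `f` on the truncation and sends the remaining nodes of `β` to fresh ones
  have hfresh : ∃ j : Node → Node, InjOn j β.nodes ∧ ∀ y, j y ∉ U := by
    obtain ⟨i, hi⟩ := Set.countable_iff_exists_injOn.1 β.nodes_countable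
    let e := (trunc_finite n α).infinite_compl.natEmbedding
    exact ⟨fun y => e (i y), fun x hx y hy hxy => hi hx hy (e.injective (Subtype.ext hxy)),
      fun y => (e (i y)).2⟩
  obtain ⟨j, hj, hjU⟩ := hfresh
  let g : Node → Node := fun y => if y ∈ f '' U then Function.invFunOn f U y else j y
  have hgf : ∀ x ∈ U, g (f x) = x := fun x hx => (if_pos ⟨x, hx, rfl⟩).trans (hinv x hx)
  have hg : InjOn g β.nodes := by
    intro y hy y' hy' e
    by_cases h₁ : y ∈ f '' U <;> by_cases h₂ : y' ∈ f '' U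
    · obtain ⟨x, hx, rfl⟩ := h₁
      obtain ⟨x', hx', rfl⟩ := h₂
      rw [hgf x hx, hgf x' hx'] at e
      rw [e]
    · obtain ⟨x, hx, rfl⟩ := h₁
      rw [hgf x hx, show g y' = j y' from if_neg h₂] at e
      exact absurd (e ▸ hx) (hjU y')
    · obtain ⟨x, hx, rfl⟩ := h₂
      rw [hgf x hx, show g y = j y from if_neg h₁] at e
      exact absurd (e ▸ hx) (hjU y)
    · rw [show g y = j y from if_neg h₁, show g y' = j y' from if_neg h₂] at e
      exact hj hy hy' e
  have hiso := β.isIso_map g hg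
  refine ⟨β.map g hg, (Pom.mk_eq_mk_iff.2 ⟨g, hiso⟩).symm, Eq.symm ?_⟩
  exact trunc_eq_of_isIso_id (((hiso.trunc n).comp h).congr hgf)

/-! ### Stabilization in directed sets -/

/-- Up to level `n`, passing from `α` to larger members of `S` adds no nodes, and below level `n` it
changes no labels. -/
def IsStable (S : Set (Pom Node L)) (n : ℕ) (α : LPOF Node L) : Prop :=
  ∀ (β : LPOF Node L) (f : Node → Node), Pom.mk β ∈ S → IsEmb α β f →
    (∀ y ∈ β.nodes, β.lev y ≤ n → y ∈ f '' α.nodes) ∧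
      ∀ x ∈ α.nodes, α.lev x < n → β.label (f x) = α.label x

variable {S : Set (Pom Node L)} {α β : LPOF Node L} {f : Node → Node} {n : ℕ}

theorem IsStable.of_isEmb (h : IsStable S n α) (hβ : Pom.mk β ∈ S) (hf : IsEmb α β f) :
    IsStable S n β := by
  intro γ g hγ hg
  obtain ⟨h₁, h₂⟩ := h γ _ hγ (hg.comp hf)
  refine ⟨fun y hy hyn => ?_, fun y hy hyn => ?_⟩
  · obtain ⟨x, hx, rfl⟩ := h₁ y hy hyn
    exact ⟨f x, hf.mapsTo hx, rfl⟩
  · obtain ⟨h₃, h₄⟩ := h β f hβ hf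
    obtain ⟨x, hx, rfl⟩ := h₃ y hy hyn.le
    rw [hf.lev_eq hx] at hyn
    exact (h₂ x hx hyn).trans (h₄ x hx hyn).symm

theorem IsStable.isIso_trunc (h : IsStable S n α) (hβ : Pom.mk β ∈ S) (hf : IsEmb α β f) :
    IsIso (trunc n α) (trunc n β) f := by
  obtain ⟨h₁, h₂⟩ := h β f hβ hf
  refine (hf.trunc n).isIso (fun y hy => ?_) fun x hx => ?_
  · obtain ⟨x, hx, rfl⟩ := h₁ y hy.1 hy.2
    exact ⟨x, ⟨hx, (hf.lev_eq hx).symm.trans_le hy.2⟩, rfl⟩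
  · rcases lt_or_ge (α.lev x) n with hn | hn
    · rw [trunc_label hx.1 hn, trunc_label (hf.mapsTo hx.1) ((hf.lev_eq hx.1).trans_lt hn),
        h₂ x hx.1 hn]
    · rw [trunc_label_of_le ((hf.lev_eq hx.1).symm ▸ hn)]
      exact bot_le

/-- Once the nodes up to level `n` are settled, their finitely many labels can only increase, and so
become constant by the ascending chain condition; from then on nothing grows out of the nodes
labelled `⊥`, and the nodes of level `n + 1` are settled as well. -/
theorem exists_isStable [WellFoundedGT L] (hS : S.Nonempty) (n : ℕ) :
    ∃ α : LPOF Node L, Pom.mk α ∈ S ∧ IsStable S n α := by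
  induction n with
  | zero =>
    obtain ⟨A, hA⟩ := hS
    obtain ⟨α, rfl⟩ := Pom.exists_mk A
    refine ⟨α, hA, fun β f hβ hf =>
      ⟨fun y hy hy0 => ?_, fun x _ hx => absurd hx (Nat.not_lt_zero _)⟩⟩
    by_contra hc
    obtain ⟨z, -, hz⟩ := hf.cut y hy hc
    have := β.lev_lt hz
    omega
  | succ n ih =>
    obtain ⟨α, hα, hst⟩ := ih
    have := (trunc_finite n α).to_subtype
    -- the labels that members of `S` above `α` give to the nodes up to level `n`
    let P : Set ((trunc n α).nodes → Lᵒᵈ) := {φ | ∃ (β : LPOF Node L) (f : Node → Node),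
      Pom.mk β ∈ S ∧ IsEmb α β f ∧ φ = fun x => OrderDual.toDual (β.label (f x.1))}
    obtain ⟨_, ⟨β, f, hβ, hf, rfl⟩, hmin⟩ :=
      (wellFounded_lt (α := (trunc n α).nodes → Lᵒᵈ)).has_min P ⟨_, α, id, hα, IsEmb.refl α, rfl⟩
    refine ⟨β, hβ, fun γ g hγ hg => ?_⟩
    have hlabel : ∀ y ∈ β.nodes, β.lev y < n + 1 → γ.label (g y) = β.label y := by
      intro y hy hyn
      obtain ⟨x, hx, rfl⟩ := (hst β f hβ hf).1 y hy (Nat.le_of_lt_succ hyn)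
      have hle : (fun x : (trunc n α).nodes => OrderDual.toDual (γ.label (g (f x)))) ≤
          fun x : (trunc n α).nodes => OrderDual.toDual (β.label (f x)) :=
        fun x => hg.label_le _ (hf.mapsTo x.2.1)
      have heq := eq_of_le_of_not_lt hle (hmin _ ⟨γ, _, hγ, hg.comp hf, rfl⟩)
      exact congrFun heq ⟨x, hx, Nat.le_of_lt_succ (hf.lev_eq hx ▸ hyn)⟩
    refine ⟨fun y hy hyn => ?_, hlabel⟩
    by_contra hc
    obtain ⟨z, hz, hzy⟩ := hg.cut y hy hc
    refine γ.not_lt_of_label_eq_bot ((hlabel z hz.1 ?_).trans hz.2) hzy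
    rw [← hg.lev_eq hz.1]
    exact (γ.lev_lt hzy).trans_le hyn

/-- Along a directed set one can pass through members that are stable at higher and higher levels,
with representatives that extend one another literally. -/
theorem exists_seq_isStable [WellFoundedGT L] [Infinite Node] (hS : S.Nonempty)
    (hdir : DirectedOn (· ≤ ·) S) : ∃ β : ℕ → LPOF Node L,
      (∀ n, Pom.mk (β n) ∈ S ∧ IsStable S n (β n)) ∧
        ∀ n, trunc n (β (n + 1)) = trunc n (β n) := by
  have step : ∀ (n : ℕ) (α : {α : LPOF Node L // Pom.mk α ∈ S ∧ IsStable S n α}),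
      ∃ β : {β : LPOF Node L // Pom.mk β ∈ S ∧ IsStable S (n + 1) β},
        trunc n β.1 = trunc n α.1 := by
    rintro n ⟨α, hα, hst⟩
    obtain ⟨α', hα', hst'⟩ := exists_isStable hS (n + 1)
    obtain ⟨B, hB, h₁, h₂⟩ := hdir _ hα _ hα'
    obtain ⟨β, rfl⟩ := Pom.exists_mk B
    obtain ⟨f, hf⟩ := Pom.mk_le_mk_iff.1 h₁
    obtain ⟨g, hg⟩ := Pom.mk_le_mk_iff.1 h₂
    obtain ⟨β', hβ', ht⟩ := exists_trunc_eq_of_isIso (hst.isIso_trunc hB hf)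
    obtain ⟨e, he⟩ := Pom.mk_eq_mk_iff.1 hβ'.symm
    exact ⟨⟨β', hβ' ▸ hB, (hst'.of_isEmb hB hg).of_isEmb (hβ' ▸ hB) he.isEmb⟩, ht⟩
  choose next hnext using step
  obtain ⟨α, hα⟩ := exists_isStable hS 0
  let β : ∀ n, {β : LPOF Node L // Pom.mk β ∈ S ∧ IsStable S n β} :=
    fun n => Nat.rec ⟨α, hα⟩ next n
  exact ⟨fun n => (β n).1, fun n => (β n).2, fun n => hnext n (β n)⟩

end LPOF

/-! ### Directed completeness of pomsets -/

namespace Pom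

open LPOF

variable {Node L : Type*} [PartialOrder L] [OrderBot L] [WellFoundedGT L] [Infinite Node]

/-- A directed set of pomsets has a supremum, of which every truncation lies below a member of the
set. -/
theorem exists_isLUB {S : Set (Pom Node L)} (hS : S.Nonempty) (hdir : DirectedOn (· ≤ ·) S) :
    ∃ γ : LPOF Node L, IsLUB S (mk γ) ∧ ∀ n, ∃ A ∈ S, mk (trunc n γ) ≤ A := by
  obtain ⟨β, hβ, ht⟩ := exists_seq_isStable hS hdir
  have ht' : ∀ n m, n ≤ m → trunc n (trunc m (β m)) = trunc n (β n) := by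
    intro n m h
    rw [trunc_trunc h]
    induction m, h using Nat.le_induction with
    | base => rfl
    | succ m h ih => rw [← ih, ← trunc_trunc h (β (m + 1)), ht m, trunc_trunc h]
  obtain ⟨γ, hγ⟩ := exists_forall_trunc_eq (fun n => trunc n (β n)) ht'
  refine ⟨γ, ⟨fun A hA => ?_, fun C hC => ?_⟩, fun n => ⟨mk (β n), (hβ n).1, ?_⟩⟩
  · obtain ⟨α, rfl⟩ := exists_mk A
    refine le_of_forall_trunc fun n => ?_
    obtain ⟨B, hB, h₁, h₂⟩ := hdir _ hA _ (hβ n).1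
    obtain ⟨δ, rfl⟩ := exists_mk B
    obtain ⟨f, hf⟩ := mk_le_mk_iff.1 h₂
    have : mk (trunc n γ) = mk (trunc n δ) := by
      rw [hγ n]
      exact mk_eq_mk_iff.2 ⟨f, (hβ n).2.isIso_trunc hB hf⟩
    rw [this]
    exact mk_trunc_mono n h₁
  · obtain ⟨δ, rfl⟩ := exists_mk C
    refine le_of_forall_trunc fun n => ?_
    rw [hγ n]
    exact mk_trunc_mono n (hC (hβ n).1)
  · rw [hγ n]
    exact mk_trunc_le n _

theorem isDCPO : IsDCPO (Pom Node L) where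
  le_refl := le_refl
  le_trans _ _ _ := le_trans
  le_antisymm _ _ := le_antisymm
  exists_isLUB S hS hdir := by
    obtain ⟨γ, hγ, -⟩ := exists_isLUB hS hdir
    exact ⟨_, hγ⟩

/-- Finite pomsets are compact. -/
theorem exists_le_of_isLUB {S : Set (Pom Node L)} (hS : S.Nonempty) (hdir : DirectedOn (· ≤ ·) S)
    {A : Pom Node L} (hA : IsLUB S A) {B : Pom Node L} (hB : B.IsFinite) (hBA : B ≤ A) :
    ∃ C ∈ S, B ≤ C := by
  obtain ⟨γ, hγ, hc⟩ := exists_isLUB hS hdir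
  obtain rfl := hA.unique hγ
  obtain ⟨β, rfl⟩ := exists_mk B
  obtain ⟨n, hn⟩ := exists_le_trunc hB hBA
  obtain ⟨C, hC, hnC⟩ := hc n
  exact ⟨C, hC, hn.trans hnC⟩

end Pom

section finApprox

variable {Node L : Type*} [PartialOrder L] [OrderBot L]

theorem finApprox_nonempty (A : Pom Node L) : (finApprox A).Nonempty := by
  obtain ⟨α, rfl⟩ := Pom.exists_mk A
  exact ⟨FinPom.mk _ (LPOF.trunc_finite 0 α), Pom.mk_trunc_le 0 α⟩

/-- Two finite approximations lie below a common truncation. -/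
theorem directedOn_finApprox (A : Pom Node L) : DirectedOn (· ≤ ·) (finApprox A) := by
  obtain ⟨α, rfl⟩ := Pom.exists_mk A
  have key : ∀ B ∈ finApprox (Pom.mk α), ∃ n, B.1 ≤ Pom.mk (LPOF.trunc n α) := by
    rintro ⟨B, hB⟩ hBA
    obtain ⟨β, rfl⟩ := Pom.exists_mk B
    exact Pom.exists_le_trunc hB hBA
  intro B hB C hC
  obtain ⟨n, hn⟩ := key B hB
  obtain ⟨m, hm⟩ := key C hC
  exact ⟨FinPom.mk _ (LPOF.trunc_finite (max n m) α), Pom.mk_trunc_le _ α,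
    hn.trans (Pom.trunc_le_trunc (le_max_left n m) α),
    hm.trans (Pom.trunc_le_trunc (le_max_right n m) α)⟩

theorem finApprox_mono {A B : Pom Node L} (h : A ≤ B) : finApprox A ⊆ finApprox B :=
  fun _ hC => le_trans (α := Pom Node L) hC h

end finApprox

/-! ### Directed completeness of labels and state functions -/

theorem IsDCPO.wellFoundedGT {X : Type*} [PartialOrder X] (h : IsDCPO X) (hX : FinitelyPreceded X) :
    WellFoundedGT X := by
  rw [wellFoundedGT_iff_monotone_chain_condition]
  intro a
  obtain ⟨x, hx⟩ := h.exists_isLUB (range a) (range_nonempty a)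
    (directedOn_range.2 a.monotone.directed_le)
  have hfin : (range a).Finite := ((hX x).insert x).subset fun y hy =>
    (hx.1 hy).eq_or_lt
  -- counting the elements below finds the maximum of the finite chain
  obtain ⟨_, ⟨n, rfl⟩, hn⟩ := exists_max_image (range a) (fun y => {z ∈ range a | z ≤ y}.ncard)
    hfin (range_nonempty a)
  refine ⟨n, fun m hm => (a.monotone hm).eq_of_not_lt fun hlt => ?_⟩
  refine (hn (a m) ⟨m, rfl⟩).not_gt (ncard_lt_ncard ⟨fun z hz => ⟨hz.1, hz.2.trans hlt.le⟩, ?_⟩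
    (hfin.subset fun z hz => hz.1))
  exact fun hs => (hs (show a m ∈ {z ∈ range a | z ≤ a m} from ⟨⟨m, rfl⟩, le_rfl⟩)).2.not_gt hlt

instance Label.wellFoundedGT {Act Test : Type*} [PartialOrder Act] [WellFoundedGT Act] :
    WellFoundedGT (Label Act Test) := by
  have hact : ∀ a : Act, Acc (· > ·) (Label.act a : Label Act Test) := by
    refine fun a => wellFounded_gt.induction
      (C := fun a : Act => Acc (· > ·) (Label.act a : Label Act Test)) a
      fun a ih => Acc.intro _ fun l hl => ?_
    obtain ⟨hle, hne⟩ := lt_iff_le_and_ne.1 hl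
    cases hle with
    | act h => exact ih _ (lt_of_le_of_ne h fun e => hne (e ▸ rfl))
  have hfork : Acc (· > ·) (Label.fork : Label Act Test) := by
    refine ⟨_, fun l hl => ?_⟩
    obtain ⟨hle, hne⟩ := lt_iff_le_and_ne.1 hl
    cases hle
    exact absurd rfl hne
  have htest : ∀ t : Test, Acc (· > ·) (Label.test t : Label Act Test) := by
    refine fun t => ⟨_, fun l hl => ?_⟩
    obtain ⟨hle, hne⟩ := lt_iff_le_and_ne.1 hl
    cases hle
    exact absurd rfl hne
  refine ⟨⟨fun l => ?_⟩⟩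
  cases l with
  | act a => exact hact a
  | fork => exact hfork
  | test t => exact htest t
  | bot =>
    refine ⟨_, fun l hl => ?_⟩
    cases l with
    | act a => exact hact a
    | fork => exact hfork
    | test t => exact htest t
    | bot => exact absurd hl (lt_irrefl _)

theorem IsDCPO.pi {ι X : Type*} [PartialOrder X] (h : IsDCPO X) : IsDCPO (ι → X) where
  le_refl _ := le_rfl
  le_trans _ _ _ h₁ h₂ := h₁.trans h₂
  le_antisymm _ _ h₁ h₂ := h₁.antisymm h₂
  exists_isLUB S hS hdir := by
    have key : ∀ i, ∃ x, IsLUB (Function.eval i '' S) x := by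
      refine fun i => h.exists_isLUB _ (hS.image _) ?_
      rintro _ ⟨f, hf, rfl⟩ _ ⟨g, hg, rfl⟩
      obtain ⟨k, hk, hfk, hgk⟩ := hdir f hf g hg
      exact ⟨k i, ⟨k, hk, rfl⟩, hfk i, hgk i⟩
    choose x hx using key
    exact ⟨x, isLUB_pi.2 hx⟩

/-! ### Linearization along embeddings -/

section bigNd

variable {T : Type*} {nd : T → T → T} {z : T}

theorem bigNd_cons (d : T) {l : List T} (hl : l ≠ []) :
    bigNd nd z (d :: l) = nd d (bigNd nd z l) := by
  cases l with
  | nil => exact absurd rfl hl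
  | cons e l => rfl

theorem bigNd_perm (assoc : ∀ d e f, nd (nd d e) f = nd d (nd e f)) (comm : ∀ d e, nd d e = nd e d)
    {l l' : List T} (h : l.Perm l') : bigNd nd z l = bigNd nd z l' := by
  induction h with
  | nil => rfl
  | cons d h ih =>
    rename_i l₁ l₂
    by_cases hl : l₁ = []
    · subst hl
      rw [List.nil_perm.1 h]
    · have hl' : l₂ ≠ [] := fun e => hl (List.perm_nil.1 (e ▸ h))
      rw [bigNd_cons d hl, bigNd_cons d hl', ih]
  | swap d e l =>
    by_cases hl : l = []
    · subst hl
      exact comm _ _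
    · rw [bigNd_cons _ (List.cons_ne_nil _ _), bigNd_cons _ hl, bigNd_cons _ (List.cons_ne_nil _ _),
        bigNd_cons _ hl, ← assoc, comm e d, assoc]
  | trans _ _ ih₁ ih₂ => exact ih₁.trans ih₂

theorem bigNd_map_le [PartialOrder T] (mono : ∀ d d' e e', d ≤ d' → e ≤ e' → nd d e ≤ nd d' e')
    {X : Type*} {f g : X → T} {l : List X} (h : ∀ x ∈ l, f x ≤ g x) :
    bigNd nd z (l.map f) ≤ bigNd nd z (l.map g) := by
  induction l with
  | nil => exact le_rfl
  | cons x l ih =>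
    by_cases hl : l = []
    · subst hl
      exact h x (List.mem_cons_self ..)
    · rw [List.map_cons, List.map_cons, bigNd_cons _ (mt List.map_eq_nil_iff.1 hl),
        bigNd_cons _ (mt List.map_eq_nil_iff.1 hl)]
      exact mono _ _ _ _ (h x (List.mem_cons_self ..))
        (ih fun y hy => h y (List.mem_cons_of_mem _ hy))

end bigNd

section Linearization

variable {Node Act Test : Type*} [PartialOrder Act] {State : Type u} {D : Type u → Type v}
  [∀ X, PartialOrder (D X)]

theorem isLUB_pair_of_le {X : Type*} [Preorder X] {a b : X} (h : a ≤ b) : IsLUB {a, b} b :=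
  IsGreatest.isLUB ⟨Or.inr rfl, fun _ hx => hx.elim (fun e => e ▸ h) fun e => e.le⟩

theorem ComputationalDomain.ext_mono (C : ComputationalDomain D State) {X Y : Type u}
    {f g : X → D Y} {d e : D X} (hfg : f ≤ g) (hde : d ≤ e) : C.ext f d ≤ C.ext g e := by
  have hf := directedOn_pair (r := (· ≤ ·)) hfg
  have he := directedOn_pair (r := (· ≤ ·)) hde
  exact (C.ext_continuous {f, g} {d, e} g e (insert_nonempty _ _) hf (isLUB_pair_of_le hfg)
    (insert_nonempty _ _) he (isLUB_pair_of_le hde)).1 ⟨f, Or.inl rfl, d, Or.inl rfl, rfl⟩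

variable (C : ComputationalDomain D State) (actSem : Act → State → D State)
  (testSem : Test → State → Bool)

/-- The contribution of the node `x` to the linearization of `α`. -/
noncomputable def linStep (α : LPOF Node (Label Act Test)) (hα : α.nodes.Finite) (ψ : Formula Node)
    (S : Set Node) (s : State) (x : Node) : D State :=
  match α.label x with
  | .act a => C.ext (fun s' => linLPO C actSem testSem α hα ψ (S ∪ {x}) s') (actSem a s)
  | .test b => linLPO C actSem testSem α hα (ψ.and (Formula.literal x (testSem b s))) (S ∪ {x}) s
  | .bot => C.bot
  | .fork => linLPO C actSem testSem α hα ψ (S ∪ {x}) s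

open Classical in
theorem linLPO_eq (α : LPOF Node (Label Act Test)) (hα : α.nodes.Finite) (ψ : Formula Node)
    (S : Set Node) (s : State) : linLPO C actSem testSem α hα ψ S s =
      if next α ψ S = ∅ then C.unit s
      else bigNd C.nd C.bot ((next_finite hα ψ S).toFinset.toList.map
        (linStep C actSem testSem α hα ψ S s)) := by
  rw [linLPO, ← List.attach_map_val (l := (next_finite hα ψ S).toFinset.toList)]
  rfl

variable {α β : LPOF Node (Label Act Test)} {f : Node → Node}

/-- Additional nodes of `β` lie above nodes that `α` labels with `⊥`, so they are not ready as long
as none of the latter has been processed. -/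
theorem LPOF.IsEmb.next_eq (h : LPOF.IsEmb α β f) {ψ : Formula Node} {S : Set Node}
    (hψ : ψ.free ⊆ α.nodes) (hS : S ⊆ α.nodes) (hbot : ∀ x ∈ S, α.label x ≠ ⊥) :
    next β (ψ.rename f) (f '' S) = f '' next α ψ S := by
  have himp : ∀ x ∈ α.nodes, (ψ.rename f).Implies (β.formula (f x)) ↔ ψ.Implies (α.formula x) := by
    intro x hx
    rw [h.formula_eq x hx, Formula.implies_rename_iff h.injOn hψ (α.formula_free_subset hx)]
  have hmem : ∀ x ∈ α.nodes, f x ∈ f '' S → x ∈ S := fun x hx hxS =>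
    (h.injOn.mem_image_iff hS hx).1 hxS
  ext y
  constructor
  · rintro ⟨⟨hy, hyS⟩, hpred, hi⟩
    have hyα : y ∈ f '' α.nodes := by
      by_contra hc
      obtain ⟨z, hz, hzy⟩ := h.cut y hy hc
      exact hbot z (hmem z hz.1 (hpred hzy)) hz.2
    obtain ⟨x, hx, rfl⟩ := hyα
    exact ⟨x, ⟨⟨hx, fun hxS => hyS ⟨x, hxS, rfl⟩⟩, fun z hz => hmem z (α.mem_left hz)
      (hpred (h.map_lt hz)), (himp x hx).1 hi⟩, rfl⟩
  · rintro ⟨x, ⟨⟨hx, hxS⟩, hpred, hi⟩, rfl⟩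
    refine ⟨⟨h.mapsTo hx, fun hc => hxS (hmem x hx hc)⟩, fun y hy => ?_, (himp x hx).2 hi⟩
    obtain ⟨z, hz, rfl⟩ := h.down_closed x hx y hy
    exact ⟨z, hpred ((h.lt_iff z hz x hx).2 hy), rfl⟩

/-- Both schedulers always have the same nodes at their disposal, up to a node that `α` labels with
`⊥`, and there the linearization of `α` stops with the least element. -/
theorem linLPO_le (hactSem : ∀ a b s, a ≤ b → actSem a s ≤ actSem b s) (h : LPOF.IsEmb α β f)
    (hα : α.nodes.Finite) (hβ : β.nodes.Finite) (ψ : Formula Node) (S : Set Node) (s : State)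
    (hψ : ψ.free ⊆ α.nodes) (hS : S ⊆ α.nodes) (hbot : ∀ x ∈ S, α.label x ≠ ⊥) :
    linLPO C actSem testSem α hα ψ S s ≤
      linLPO C actSem testSem β hβ (ψ.rename f) (f '' S) s := by
  classical
  induction hk : (α.nodes \ S).ncard using Nat.strong_induction_on generalizing ψ S s with
  | _ k ih =>
    have hnext := h.next_eq hψ hS hbot
    rw [linLPO_eq, linLPO_eq]
    by_cases he : next α ψ S = ∅
    · rw [if_pos he, if_pos (by rw [hnext, he, image_empty])]
    rw [if_neg he, if_neg (by rwa [hnext, image_eq_empty])]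
    have hperm : (next_finite hβ (ψ.rename f) (f '' S)).toFinset.toList.Perm
        ((next_finite hα ψ S).toFinset.toList.map f) := by
      refine (List.perm_ext_iff_of_nodup (Finset.nodup_toList _) ?_).2 fun y => ?_
      · refine (Finset.nodup_toList _).map_on fun x hx y hy e => h.injOn ?_ ?_ e
        · rw [Finset.mem_toList, Set.Finite.mem_toFinset] at hx
          exact hx.1.1
        · rw [Finset.mem_toList, Set.Finite.mem_toFinset] at hy
          exact hy.1.1
      · rw [Finset.mem_toList, Set.Finite.mem_toFinset, hnext, List.mem_map]
        simp only [Finset.mem_toList, Set.Finite.mem_toFinset, mem_image]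
    rw [bigNd_perm C.nd_assoc C.nd_comm (hperm.map _), List.map_map]
    refine bigNd_map_le C.nd_mono fun x hx => ?_
    rw [Finset.mem_toList, Set.Finite.mem_toFinset] at hx
    have hstep : ∀ ψ' : Formula Node, ψ'.free ⊆ α.nodes → α.label x ≠ ⊥ → ∀ s',
        linLPO C actSem testSem α hα ψ' (S ∪ {x}) s' ≤
          linLPO C actSem testSem β hβ (ψ'.rename f) (f '' S ∪ {f x}) s' := by
      intro ψ' hψ' hx' s'
      rw [← image_singleton, ← image_union]
      refine ih _ (hk ▸ ncard_diff_insert_lt hα hx.1) ψ' _ s' hψ' ?_ ?_ rfl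
      · exact union_subset hS (singleton_subset_iff.2 hx.1.1)
      · rintro y (hy | rfl)
        exacts [hbot y hy, hx']
    have hle := h.label_le x hx.1.1
    rw [Function.comp_apply, linStep, linStep]
    generalize hlα : α.label x = l at hle hstep
    generalize β.label (f x) = l' at hle
    cases hle with
    | bot => exact C.bot_le _
    | fork => exact hstep ψ hψ nofun s
    | act hab => exact C.ext_mono (fun s' => hstep ψ hψ nofun s') (hactSem _ _ s hab)
    | test t =>
      have := hstep (ψ.and (Formula.literal x (testSem t s)))
        (union_subset hψ (by
          rw [Formula.free_literal]
          exact singleton_subset_iff.2 hx.1.1)) nofun s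
      rwa [Formula.rename, Formula.rename_literal] at this

theorem linLPO_tru_le (hactSem : ∀ a b s, a ≤ b → actSem a s ≤ actSem b s) (h : LPOF.IsEmb α β f)
    (hα : α.nodes.Finite) (hβ : β.nodes.Finite) :
    linLPO C actSem testSem α hα Formula.tru ∅ ≤ linLPO C actSem testSem β hβ Formula.tru ∅ := by
  intro s
  have := linLPO_le C actSem testSem hactSem h hα hβ Formula.tru ∅ s (empty_subset _)
    (empty_subset _) fun x hx => absurd hx (notMem_empty x)
  rwa [image_empty] at this

theorem linFin_mk (hactSem : ∀ a b s, a ≤ b → actSem a s ≤ actSem b s) (hα : α.nodes.Finite) :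
    linFin C actSem testSem (FinPom.mk α hα) = linLPO C actSem testSem α hα Formula.tru ∅ := by
  have hrep : Pom.mk (FinPom.mk α hα).rep = Pom.mk α := Quotient.out_eq (Pom.mk α)
  obtain ⟨f, hf⟩ := Pom.mk_eq_mk_iff.1 hrep
  obtain ⟨g, hg⟩ := Pom.mk_eq_mk_iff.1 hrep.symm
  exact le_antisymm (linLPO_tru_le C actSem testSem hactSem hf.isEmb _ _)
    (linLPO_tru_le C actSem testSem hactSem hg.isEmb _ _)

theorem linFin_mono (hactSem : ∀ a b s, a ≤ b → actSem a s ≤ actSem b s)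
    {A B : FinPom Node (Label Act Test)} (h : A.1 ≤ B.1) :
    linFin C actSem testSem A ≤ linFin C actSem testSem B := by
  have hA : Pom.mk A.rep = A.1 := Quotient.out_eq A.1
  have hB : Pom.mk B.rep = B.1 := Quotient.out_eq B.1
  rw [← hA, ← hB] at h
  obtain ⟨f, hf⟩ := Pom.mk_le_mk_iff.1 h
  exact linLPO_tru_le C actSem testSem hactSem hf _ _

theorem isLUB_lin (hactSem : ∀ a b s, a ≤ b → actSem a s ≤ actSem b s)
    (A : Pom Node (Label Act Test)) :
    IsLUB (linFin C actSem testSem '' finApprox A) (lin C actSem testSem A) := by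
  have h : ∃ t, IsLUB (linFin C actSem testSem '' finApprox A) t := by
    refine (C.isDCPO State).pi.exists_isLUB _ ((finApprox_nonempty A).image _) ?_
    rintro _ ⟨B, hB, rfl⟩ _ ⟨B', hB', rfl⟩
    obtain ⟨B'', hB'', h₁, h₂⟩ := directedOn_finApprox A B hB B' hB'
    exact ⟨_, ⟨B'', hB'', rfl⟩, linFin_mono C actSem testSem hactSem h₁,
      linFin_mono C actSem testSem hactSem h₂⟩
  have hl : lin C actSem testSem A = h.choose := dif_pos h
  exact hl ▸ h.choose_spec

theorem lin_mono (hactSem : ∀ a b s, a ≤ b → actSem a s ≤ actSem b s)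
    {A B : Pom Node (Label Act Test)} (h : A ≤ B) :
    lin C actSem testSem A ≤ lin C actSem testSem B :=
  (isLUB_lin C actSem testSem hactSem A).mono (isLUB_lin C actSem testSem hactSem B)
    (image_mono (finApprox_mono h))

theorem isScottContinuous_lin [Infinite Node] [WellFoundedGT Act]
    (hactSem : ∀ a b s, a ≤ b → actSem a s ≤ actSem b s) :
    IsScottContinuous (lin C actSem testSem : Pom Node (Label Act Test) → State → D State) where
  mono _ _ h := lin_mono C actSem testSem hactSem h
  isLUB_image S hS hdir A hA := by
    refine ⟨?_, fun u hu => (isLUB_lin C actSem testSem hactSem A).2 ?_⟩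
    · rintro _ ⟨B, hB, rfl⟩
      exact lin_mono C actSem testSem hactSem (hA.1 hB)
    · rintro _ ⟨B, hB, rfl⟩
      obtain ⟨E, hE, hBE⟩ := Pom.exists_le_of_isLUB hS hdir hA B.2 hB
      exact ((isLUB_lin C actSem testSem hactSem E).1 ⟨B, hBE, rfl⟩).trans (hu ⟨E, hE, rfl⟩)

end Linearization

theorem mainTheorem8 {Node Act Test : Type*} [Infinite Node] [PartialOrder Act]
    (hAct : IsDCPO Act) (hAct' : FinitelyPreceded Act)
    {State : Type u} {D : Type u → Type v} [∀ X, PartialOrder (D X)]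
    (C : ComputationalDomain D State)
    (actSem : Act → State → D State) (hactSem : ∀ a b s, a ≤ b → actSem a s ≤ actSem b s)
    (testSem : Test → State → Bool) :
    -- linearization of a finite pomset may be computed on any representative
    (∀ (α : LPOF Node (Label Act Test)) (hα : α.nodes.Finite),
      linFin C actSem testSem (FinPom.mk α hα) =
        linLPO C actSem testSem α hα Formula.tru ∅) ∧
    -- linearization of finite pomsets is monotone
    (∀ A B : FinPom Node (Label Act Test), A.1 ≤ B.1 →
      linFin C actSem testSem A ≤ linFin C actSem testSem B) ∧
    -- the suprema that define `lin` exist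
    (∀ A : Pom Node (Label Act Test),
      IsLUB (linFin C actSem testSem '' finApprox A) (lin C actSem testSem A)) ∧
    -- `lin` is a Scott continuous map between dcpos
    IsDCPO (Pom Node (Label Act Test)) ∧
    IsDCPO (State → D State) ∧
    IsScottContinuous (lin C actSem testSem : Pom Node (Label Act Test) → State → D State) := by
  have := hAct.wellFoundedGT hAct'
  exact ⟨fun _ hα => linFin_mk C actSem testSem hactSem hα,
    fun _ _ h => linFin_mono C actSem testSem hactSem h,
    isLUB_lin C actSem testSem hactSem, Pom.isDCPO, (C.isDCPO State).pi,
    isScottContinuous_lin C actSem testSem hactSem⟩
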